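/- Let $e\in\mathbb R$, $c>0$, $\mu>0$, let $\phi\in C^\infty(\mathbb R\times\mathbb R^3;\mathbb R)$, $A\in C^\infty(\mathbb R\times\mathbb R^3;\mathbb R^3)$, $S_0\in C^\infty(\mathbb R^3;\mathbb R)$, $a_0\in C^\infty(\mathbb R^3;\mathbb C)$, and put $$H(x,p,t)=e\,\phi(t,x)+\frac1{2\mu}\Big|p-\frac ec A(t,x)\Big|^2 .$$ For $x_0\in\mathbb R^3$ let $(x(t,x_0),p(t,x_0))$ be the solution of $\dot x=H_p(x,p,t)$, $\dot p=-H_x(x,p,t)$, $x|_{t=0}=x_0$, $p|_{t=0}=\nabla S_0(x_0)$; it exists for $|t|<T(x_0)$. Let $$\mathcal T=\{(t,x(t,x_0)):\ x_0\in\operatorname{supp}a_0,\ |t|<T(x_0)\}$$ be the ray tube, where $\operatorname{supp}a_0$ is the closed support. Let $T>0$, and suppose that for all $|t|<T$ the solutions $(x(t,x_0),p(t,x_0))$ exist for every $x_0\in\mathbb R^3$ and the map $x_0\mapsto x(t,x_0)$ is a $C^\infty$-diffeomorphism of $\mathbb R^3$ onto $\mathbb R^3$. Then the Cauchy problem $$(i\hbar\partial_t-e\phi)\psi=\frac1{2\mu}\Big(-i\hbar\nabla-\frac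 ec A\Big)^2\psi,\qquad \psi|_{t=0}=a_0\,e^{iS_0/\hbar}$$ has a formal Debye expansion $\psi\sim\big(\sum_{k\ge0}\hbar^k a_k(t,x)\big)e^{iS(t,x)/\hbar}$, $\hbar\to0$, for $|t|<T$. That is, there are a real function $S$ and complex functions $a_k$ ($k\ge 0$), independent of $\hbar$ and $C^\infty$ on $\{|t|<T\}\times\mathbb R^3$, such that 1. $-\partial_tS=H(x,\nabla S,t)$ for $|t|<T$, and $S|_{t=0}=S_0$; 2. $a_0(0,x)=a_0(x)$, and $a_k(0,x)=0$ for $k\ge1$; 3. the series satisfies the Schrödinger equation formally to all orders in $\hbar$: for every $N\ge0$ and every compact $K\subset\{|t|<T\}\times\mathbb R^3$ there is a constant $C$ such that $\psi_N=\big(\sum_{k=0}^N\hbar^ka_k\big)e^{iS/\hbar}$ satisfies $$\Big|(i\hbar\partial_t-e\phi)\psi_N-\frac1{2\mu}\Big(-i\hbar\nabla-\frac ec A\Big)^2\psi_N\Big|\le C\,\hbar^{N+2}\quad\text{on }K,\ 0<\hbar\le1.$$ Moreover, these can be chosen so that the expansion is identically zero outside $\mathcal T$: $a_k(t,x)=0$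 whenever $|t|<T$, $(t,x)\notin\mathcal T$, $k=0,1,2,\dots$ -/

import Mathlib

open Set
open scoped ContDiff Manifold Gradient

noncomputable section

namespace WKB

/-- Physical space `ℝ³` with its Euclidean norm. -/
abbrev Space : Type := EuclideanSpace ℝ (Fin 3)

/-- Space-time `ℝ × ℝ³`; points are written `(t, x)`. -/
abbrev SpaceTime : Type := ℝ × Space

/-- The Hamiltonian `H(x,p,t) = e φ(t,x) + (1/(2μ)) |p - (e/c) A(t,x)|²` of a nonrelativistic
particle of charge `e` and mass `μ` in the Maxwell field with potentials `φ`, `A`. -/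
def hamiltonian (e c μ : ℝ) (φ : SpaceTime → ℝ) (A : SpaceTime → Space)
    (x p : Space) (t : ℝ) : ℝ :=
  e * φ (t, x) + 1 / (2 * μ) * ‖p - (e / c) • A (t, x)‖ ^ 2

/-- `(x, p)` solves, for `|t| < τ`, the Hamilton system `ẋ = H_p`, `ṗ = -H_x` with the initial
conditions `x(0) = x₀`, `p(0) = ∇S₀(x₀)`. -/
structure IsRay (e c μ : ℝ) (φ : SpaceTime → ℝ) (A : SpaceTime → Space) (S₀ : Space → ℝ)
    (x₀ : Space) (τ : ℝ) (x p : ℝ → Space) : Prop where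
  x_zero : x 0 = x₀
  p_zero : p 0 = ∇ S₀ x₀
  x_eq : ∀ t : ℝ, |t| < τ →
    HasDerivAt x (∇ (fun q : Space => hamiltonian e c μ φ A (x t) q t) (p t)) t
  p_eq : ∀ t : ℝ, |t| < τ →
    HasDerivAt p (-∇ (fun y : Space => hamiltonian e c μ φ A y (p t) t) (x t)) t

/-- The ray tube emanating from `a₀ e^{iS₀/h}`: all points `(t, x(t,x₀))` on rays that start at
a point `x₀` of the (closed) support of `a₀`, as long as the ray exists. -/
def rayTube (e c μ : ℝ) (φ : SpaceTime → ℝ) (A : SpaceTime → Space) (S₀ : Space → ℝ)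
    (a₀ : Space → ℂ) : Set SpaceTime :=
  {z | ∃ x₀ ∈ tsupport a₀, ∃ (τ : ℝ) (x p : ℝ → Space),
    IsRay e c μ φ A S₀ x₀ τ x p ∧ |z.1| < τ ∧ x z.1 = z.2}

/-- The time slab `{(t, x) : |t| < T}`. -/
def slab (T : ℝ) : Set SpaceTime := {z | |z.1| < T}

/-- The time derivative `∂_t ψ`. -/
def timeDeriv (ψ : SpaceTime → ℂ) (z : SpaceTime) : ℂ :=
  deriv (fun s : ℝ => ψ (s, z.2)) z.1

/-- The spatial partial derivative `∂_j ψ`. -/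
def spaceDeriv (j : Fin 3) (ψ : SpaceTime → ℂ) (z : SpaceTime) : ℂ :=
  fderiv ℝ (fun y : Space => ψ (z.1, y)) z.2 (EuclideanSpace.single j 1)

/-- The `j`-th component `-i h ∂_j - (e/c) A_j` of the kinetic momentum operator. -/
def momentum (e c h : ℝ) (A : SpaceTime → Space) (j : Fin 3) (ψ : SpaceTime → ℂ)
    (z : SpaceTime) : ℂ :=
  -Complex.I * h * spaceDeriv j ψ z - ((e / c * A z j : ℝ) : ℂ) * ψ z

/-- The Schrödinger operator
`ψ ↦ (i h ∂_t - e φ) ψ - (1/(2μ)) (-i h ∇ - (e/c) A)² ψ`;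
`ψ` solves the Schrödinger equation where this vanishes. -/
def schrodinger (e c μ h : ℝ) (φ : SpaceTime → ℝ) (A : SpaceTime → Space) (ψ : SpaceTime → ℂ)
    (z : SpaceTime) : ℂ :=
  Complex.I * h * timeDeriv ψ z - ((e * φ z : ℝ) : ℂ) * ψ z
    - ((1 / (2 * μ) : ℝ) : ℂ) * ∑ j : Fin 3, momentum e c h A j (momentum e c h A j ψ) z

/-- The partial sum `(∑_{k ≤ N} h^k a_k) e^{iS/h}`. -/
def debyeSum (S : SpaceTime → ℝ) (a : ℕ → SpaceTime → ℂ) (h : ℝ) (N : ℕ) (z : SpaceTime) : ℂ :=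
  (∑ k ∈ Finset.range (N + 1), (h : ℂ) ^ k * a k z) * Complex.exp (Complex.I * S z / h)

/-- `(∑_k h^k a_k) e^{iS/h}` is, for `|t| < T`, a formal Debye expansion of the solution of the
Cauchy problem for the Schrödinger equation with `ψ|_{t=0} = a₀ e^{iS₀/h}`.

The real phase `S` and the amplitudes `a_k` do not depend on `h`. The phase solves the
Hamilton-Jacobi equation; the initial conditions hold at each order in `h`; and the formal series
satisfies the Schrödinger equation to all orders in `h`. The last point is expressed by partial
sums: applying the Schrödinger operator to a single term `h^k a_k e^{iS/h}` gives `e^{iS/h}` times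
a combination of `h^k`, `h^(k+1)`, `h^(k+2)`, where the `h^k` coefficient vanishes by the
Hamilton-Jacobi equation; so the terms after the `N`-th contribute only from order `h^(N+2)` on, and
the formal equation holds iff, for every `N`, the `N`-th partial sum satisfies the equation up to
`O(h^(N+2))`. -/
structure IsDebyeExpansion (e c μ : ℝ) (φ : SpaceTime → ℝ) (A : SpaceTime → Space)
    (S₀ : Space → ℝ) (a₀ : Space → ℂ) (T : ℝ) (S : SpaceTime → ℝ) (a : ℕ → SpaceTime → ℂ) :
    Prop where
  phase_smooth : ContDiffOn ℝ ∞ S (slab T)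
  amplitude_smooth : ∀ k, ContDiffOn ℝ ∞ (a k) (slab T)
  hamilton_jacobi : ∀ z ∈ slab T,
    -deriv (fun s : ℝ => S (s, z.2)) z.1
      = hamiltonian e c μ φ A z.2 (∇ (fun y : Space => S (z.1, y)) z.2) z.1
  phase_initial : ∀ x, S (0, x) = S₀ x
  amplitude_initial_zero : ∀ x, a 0 (0, x) = a₀ x
  amplitude_initial_succ : ∀ k x, a (k + 1) (0, x) = 0
  formal_solution : ∀ (N : ℕ) (K : Set SpaceTime), IsCompact K → K ⊆ slab T →
    ∃ C : ℝ, ∀ h : ℝ, 0 < h → h ≤ 1 → ∀ z ∈ K,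
      ‖schrodinger e c μ h φ A (debyeSum S a h N) z‖ ≤ C * h ^ (N + 2)

end WKB

end

/-! The proof is the method of characteristics, first for the phase and then for the amplitudes.
Along the rays the action `s = S₀ + ∫ (⟨p, H_p⟩ - H) dt` satisfies `ds = ⟨p, dx⟩ - H dt`
(`exists_action`). Since `(t, q) ↦ (t, x(t, q))` is a diffeomorphism of the slab, `s` becomes a
function `S` of `(t, y)` with `∇S = p` and `∂_t S = -H` (`exists_phase`).

With this phase, the Schrödinger operator sends `a e^{iS/h}` to `(i h L a + h²/(2μ) Δa) e^{iS/h}`,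
where `L` is a first-order operator (`schrodinger_mul_wave`). The equations `L a_0 = 0` and `L
a_{k+1} = (i/(2μ)) Δ a_k` make the sum telescope, leaving only `h^(N+2)/(2μ) Δ a_N`
(`schrodinger_debyeSum`). By `transport_eq_of_phase`, `L` is differentiation along the rays plus a
multiplication, so each equation is a linear ODE on every ray and is solved by an integrating factor
(`exists_transport`). Rays that start off the closed support of `a₀` form an open set on which all
the amplitudes vanish inductively (`exists_amplitudes`).

All of this needs the rays to be jointly smooth in time and starting point. This is proved by
applying the implicit function theorem in `C([0,1], E)` to get a local flow, and then continuing
along the ray by connectedness (`contDiffAt_integralCurves`). -/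

noncomputable section

namespace WKB

open Filter Topology

/-! ### Superposition operators on spaces of continuous functions -/

section Superposition

variable {K : Type*} [TopologicalSpace K] [CompactSpace K]

/-- Pointwise application of a continuous family of operators to a continuous function. -/
def pointwiseApply (K : Type*) [TopologicalSpace K] [CompactSpace K]
    (E F : Type*) [NormedAddCommGroup E] [NormedSpace ℝ E] [NormedAddCommGroup F]
    [NormedSpace ℝ F] : C(K, E →L[ℝ] F) →L[ℝ] C(K, E) →L[ℝ] C(K, F) :=
  LinearMap.mkContinuous₂
    (LinearMap.mk₂ ℝ (fun (g : C(K, E →L[ℝ] F)) (u : C(K, E)) =>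
        (⟨fun s => g s (u s), by fun_prop⟩ : C(K, F)))
      (by intros; ext; simp) (by intros; ext; simp) (by intros; ext; simp)
      (by intros; ext; simp))
    1 (by
      intro g u
      refine (ContinuousMap.norm_le _ (by positivity)).2 fun s => ?_
      rw [one_mul]
      exact ((g s).le_opNorm _).trans
        (mul_le_mul (g.norm_coe_le_norm s) (u.norm_coe_le_norm s) (norm_nonneg _) (norm_nonneg g)))

/-- The superposition operator `u ↦ f ∘ u` of a `C¹` function `f` is differentiable. -/
theorem hasFDerivAt_superposition {E F : Type*} [NormedAddCommGroup E] [NormedSpace ℝ E]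
    [NormedAddCommGroup F] [NormedSpace ℝ F] (f : C(E, F)) (f' : C(E, E →L[ℝ] F))
    (hf : ∀ x, HasFDerivAt f (f' x) x) (u : C(K, E)) :
    HasFDerivAt (fun v : C(K, E) => f.comp v) (pointwiseApply K E F (f'.comp u)) u := by
  rw [hasFDerivAt_iff_isLittleO, Asymptotics.isLittleO_iff]
  intro c hc
  have hcont := (ContinuousMap.continuous_postcomp (X := K) f').continuousAt (x := u)
  obtain ⟨δ, hδ, hball⟩ := (Metric.continuousAt_iff (α := C(K, E))
    (β := C(K, E →L[ℝ] F))).1 hcont c hc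
  -- Perturbing `u` by the constant function `h` turns sup-norm continuity of `v ↦ f' ∘ v` into an
  -- estimate uniform in `s`. The mean value inequality on balls then gives the remainder bound.
  have key : ∀ (s : K) (h : E), ‖h‖ < δ → ‖f' (u s + h) - f' (u s)‖ ≤ c := by
    intro s h hh
    have h1 : dist (u + ContinuousMap.const K h) u < δ := by
      rw [dist_eq_norm, add_sub_cancel_left]
      exact lt_of_le_of_lt ((ContinuousMap.norm_le _ (norm_nonneg h)).2 fun _ => le_rfl) hh
    have h2 := (ContinuousMap.dist_apply_le_dist s).trans (hball h1).le
    simpa [dist_eq_norm] using h2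
  filter_upwards [Metric.ball_mem_nhds u hδ] with v hv
  refine (ContinuousMap.norm_le _ (by positivity)).2 fun s => ?_
  have hvs : ‖v s - u s‖ ≤ ‖v - u‖ := (v - u).norm_coe_le_norm s
  have hvu : ‖v - u‖ < δ := by rwa [← dist_eq_norm]
  have hmv := Convex.norm_image_sub_le_of_norm_hasFDerivWithin_le' (𝕜 := ℝ) (f := f) (f' := f')
    (φ := f' (u s)) (C := c) (s := Metric.ball (u s) δ) (x := u s) (y := v s)
    (fun x _ => (hf x).hasFDerivWithinAt)
    (fun x hx => by
      have := key s (x - u s) (by rwa [← dist_eq_norm])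
      simpa using this)
    (convex_ball _ _) (Metric.mem_ball_self hδ)
    (by rw [Metric.mem_ball, dist_eq_norm]; exact lt_of_le_of_lt hvs hvu)
  exact hmv.trans (by gcongr)

universe w

/-- The superposition operator of a `Cⁿ` function is `Cⁿ`. -/
theorem contDiff_superposition {E : Type w} [NormedAddCommGroup E] [NormedSpace ℝ E] (n : ℕ) :
    ∀ {F : Type w} [NormedAddCommGroup F] [NormedSpace ℝ F] (f : C(E, F)),
      ContDiff ℝ n f → ContDiff ℝ n (fun v : C(K, E) => f.comp v) := by
  induction n with
  | zero =>
    intro F _ _ f _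
    rw [Nat.cast_zero, contDiff_zero]
    exact ContinuousMap.continuous_postcomp f
  | succ n ih =>
    -- The derivative is superposition with `f'` followed by a fixed bounded bilinear map. The
    -- induction hypothesis is applied to `f'`, so it must range over codomains and include `E →L[ℝ]
    -- F`, which stays in the same universe.
    intro F _ _ f hf
    rw [Nat.cast_succ] at hf ⊢
    obtain ⟨f', hf', hd⟩ := contDiff_succ_iff_hasFDerivAt.1 hf
    refine contDiff_succ_iff_hasFDerivAt.2
      ⟨fun v => pointwiseApply K E F ((⟨f', hf'.continuous⟩ : C(E, E →L[ℝ] F)).comp v), ?_, ?_⟩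
    · exact (pointwiseApply K E F).contDiff.comp (ih ⟨f', hf'.continuous⟩ hf')
    · exact fun v => hasFDerivAt_superposition f ⟨f', hf'.continuous⟩ hd v

end Superposition

/-! ### Smooth dependence of integral curves on time and initial value -/

section Flow

variable {E : Type*} [NormedAddCommGroup E] [NormedSpace ℝ E]

/-- Continuous functions on the unit interval, extended by constants. -/
def extendUnit {E : Type*} [NormedAddCommGroup E] (u : C(Icc (0 : ℝ) 1, E)) (r : ℝ) : E := u (projIcc 0 1 zero_le_one r)

theorem continuous_extendUnit {E : Type*} [NormedAddCommGroup E] (u : C(Icc (0 : ℝ) 1, E)) : Continuous (extendUnit u) :=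
  u.continuous.comp continuous_projIcc

/-- The primitive vanishing at `0`, as an operator on continuous functions on `[0, 1]`. -/
def primitiveUnit (E : Type*) [NormedAddCommGroup E] [NormedSpace ℝ E] :
    C(Icc (0 : ℝ) 1, E) →L[ℝ] C(Icc (0 : ℝ) 1, E) :=
  LinearMap.mkContinuous
    { toFun := fun u => ⟨fun s => ∫ r in (0 : ℝ)..s, extendUnit u r, by
        exact (intervalIntegral.continuous_primitive
          (fun a b => (continuous_extendUnit u).intervalIntegrable a b) 0).comp
            continuous_subtype_val⟩
      map_add' := by
        intro u v
        ext s
        exact intervalIntegral.integral_add ((continuous_extendUnit u).intervalIntegrable _ _)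
          ((continuous_extendUnit v).intervalIntegrable _ _)
      map_smul' := by
        intro c u
        ext s
        exact intervalIntegral.integral_smul c (extendUnit u) }
    1 (by
      intro u
      refine (ContinuousMap.norm_le _ (by positivity)).2 fun s => ?_
      have h := intervalIntegral.norm_integral_le_of_norm_le_const (a := 0) (b := (s : ℝ))
        (f := extendUnit u) (C := ‖u‖) (fun r _ => u.norm_coe_le_norm _)
      refine h.trans ?_
      rw [sub_zero, abs_of_nonneg s.2.1, mul_comm]
      exact mul_le_mul_of_nonneg_right s.2.2 (norm_nonneg u))

/-- Two solutions on `[0, 1]` of an autonomous equation with `C¹` right-hand side agree if they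
agree at `0`. -/
theorem eqOn_unit_of_hasDerivAt {g : E → E} (hg : ContDiff ℝ 1 g) {u v : ℝ → E}
    (hu : ∀ s ∈ Icc (0 : ℝ) 1, HasDerivAt u (g (u s)) s)
    (hv : ∀ s ∈ Icc (0 : ℝ) 1, HasDerivAt v (g (v s)) s) (h0 : u 0 = v 0) :
    EqOn u v (Icc 0 1) := by
  have hcu : ContinuousOn u (Icc 0 1) := fun s hs => (hu s hs).continuousAt.continuousWithinAt
  have hcv : ContinuousOn v (Icc 0 1) := fun s hs => (hv s hs).continuousAt.continuousWithinAt
  -- A `C¹` field is only locally Lipschitz; compactness of the two trajectories gives one constant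
  -- on their union.
  obtain ⟨L, hL⟩ := (hg.locallyLipschitz.locallyLipschitzOn
    (s := u '' Icc 0 1 ∪ v '' Icc 0 1)).exists_lipschitzOnWith_of_compact
    ((isCompact_Icc.image_of_continuousOn hcu).union (isCompact_Icc.image_of_continuousOn hcv))
  exact ODE_solution_unique_of_mem_Icc_right (v := fun _ => g) (s := fun _ => _)
    (fun _ _ => hL) hcu (fun s hs => (hu s (Ico_subset_Icc_self hs)).hasDerivWithinAt)
    (fun s hs => Or.inl (mem_image_of_mem _ (Ico_subset_Icc_self hs))) hcv
    (fun s hs => (hv s (Ico_subset_Icc_self hs)).hasDerivWithinAt)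
    (fun s hs => Or.inr (mem_image_of_mem _ (Ico_subset_Icc_self hs))) h0

/-- Locally, integral curves of a `Cⁿ` vector field are given by a `Cⁿ` function of time and
initial value. The curve with initial value `y` at the time `ε` is the value at `1` of the solution
of `u' = ε f(u)`, `u(0) = y`, to which the implicit function theorem applies at `ε = 0`. -/
theorem exists_contDiffAt_localFlow [CompleteSpace E] {f : E → E} {n : ℕ} (hn : 1 ≤ n)
    (hf : ContDiff ℝ n f) (y₀ : E) :
    ∃ Φ : ℝ × E → E, ContDiffAt ℝ n Φ (0, y₀) ∧
      ∀ᶠ w : ℝ × E in 𝓝 (0, y₀), ∀ γ : ℝ → E, γ 0 = w.2 →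
        (∀ t ∈ uIcc 0 w.1, HasDerivAt γ (f (γ t)) t) → γ w.1 = Φ w := by
  let X := C(Icc (0 : ℝ) 1, E)
  let fc : C(E, E) := ⟨f, hf.continuous⟩
  let cst : E →L[ℝ] X := ContinuousLinearMap.const ℝ (Icc (0 : ℝ) 1)
  let G : (ℝ × E) × X → X := fun w =>
    w.2 - cst w.1.2 - w.1.1 • primitiveUnit E (fc.comp w.2)
  have hN : ContDiff ℝ n (fun v : X => fc.comp v) := contDiff_superposition n fc hf
  have hG : ContDiff ℝ n G := by
    refine (contDiff_snd.sub (cst.contDiff.comp (contDiff_snd.comp contDiff_fst))).sub ?_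
    exact (contDiff_fst.comp contDiff_fst).smul
      ((primitiveUnit E).contDiff.comp (hN.comp contDiff_snd))
  let w₀ : (ℝ × E) × X := ((0, y₀), cst y₀)
  have hn0 : (n : WithTop ℕ∞) ≠ 0 := by
    simpa using Nat.one_le_iff_ne_zero.1 hn
  have hinv : (fderiv ℝ G w₀ ∘L .inr ℝ (ℝ × E) X).IsInvertible := by
    have h1 : HasFDerivAt (fun v : X => G ((0, y₀), v))
        (fderiv ℝ G w₀ ∘L .inr ℝ (ℝ × E) X) (cst y₀) :=
      ((hG.differentiable hn0) w₀).hasFDerivAt.comp (cst y₀) (hasFDerivAt_prodMk_right _ _)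
    -- At `ε = 0` the integral term drops out, so the partial derivative is the identity.
    have h2 : HasFDerivAt (fun v : X => G ((0, y₀), v)) (ContinuousLinearMap.id ℝ X) (cst y₀) := by
      have : (fun v : X => G ((0, y₀), v)) = fun v => v - cst y₀ := by
        funext v; simp [G]
      rw [this]
      exact (hasFDerivAt_id _).sub_const _
    rw [h1.unique h2]
    exact ⟨ContinuousLinearEquiv.refl ℝ X, rfl⟩
  have hGw := hG.contDiffAt (x := w₀)
  let ψ := hGw.implicitFunction hn0 hinv
  refine ⟨fun w => ψ w ⟨1, by simp⟩, ?_, ?_⟩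
  · exact (ContinuousMap.evalCLM ℝ (⟨1, by simp⟩ : Icc (0 : ℝ) 1)).contDiff.contDiffAt.comp _
      (hGw.contDiffAt_implicitFunction hn0 hinv)
  · filter_upwards [hGw.eventually_apply_implicitFunction hn0 hinv] with w hw γ hγ0 hγ
    obtain ⟨ε, y⟩ := w
    have hG0 : G w₀ = 0 := by simp [G, w₀]
    set u : X := ψ (ε, y) with hu
    have hfix : ∀ s : Icc (0 : ℝ) 1, u s = y + ε • ∫ r in (0 : ℝ)..s, f (extendUnit u r) := by
      intro s
      have h := DFunLike.congr_fun (hw.trans hG0) s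
      have h' : u s - y - ε • ∫ r in (0 : ℝ)..s, f (extendUnit u r) = 0 := h
      rw [sub_sub, sub_eq_zero] at h'
      exact h'
    -- The fixed-point formula extends `u` to all of `ℝ`, which gives two-sided derivatives at the
    -- endpoints of `[0, 1]`.
    let U : ℝ → E := fun s => y + ε • ∫ r in (0 : ℝ)..s, f (extendUnit u r)
    have hUu : ∀ s (hs : s ∈ Icc (0 : ℝ) 1), U s = extendUnit u s := by
      intro s hs
      rw [extendUnit, projIcc_of_mem _ hs, hfix ⟨s, hs⟩]
    have hU : ∀ s ∈ Icc (0 : ℝ) 1, HasDerivAt U (ε • f (U s)) s := by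
      intro s hs
      rw [hUu s hs]
      have hc : Continuous fun r => f (extendUnit u r) :=
        hf.continuous.comp (continuous_extendUnit u)
      exact ((hc.integral_hasStrictDerivAt 0 s).hasDerivAt.const_smul ε).const_add y
    have hV : ∀ s ∈ Icc (0 : ℝ) 1, HasDerivAt (fun s => γ (ε * s)) (ε • f (γ (ε * s))) s := by
      intro s hs
      have hmem : ε * s ∈ uIcc 0 ε := by
        rcases le_total 0 ε with h | h
        · rw [uIcc_of_le h]
          exact ⟨mul_nonneg h hs.1, mul_le_of_le_one_right h hs.2⟩
        · rw [uIcc_of_ge h]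
          exact ⟨by nlinarith [hs.2], mul_nonpos_of_nonpos_of_nonneg h hs.1⟩
      have h1 : HasDerivAt (fun s : ℝ => ε * s) ε s := by
        simpa using (hasDerivAt_id s).const_mul ε
      exact (hγ _ hmem).scomp s h1
    have heq := eqOn_unit_of_hasDerivAt (g := fun z => ε • f z)
      (contDiff_const.smul (hf.of_le (by exact_mod_cast hn))) hV hU
      (by simpa [U] using hγ0) (right_mem_Icc.2 zero_le_one)
    simp only [mul_one] at heq
    rw [heq, hUu 1 (by simp), extendUnit, projIcc_of_mem _ (by simp)]

/-- A family of integral curves of a smooth vector field with smooth initial values depends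
smoothly on time and parameter. -/
theorem contDiffAt_integralCurves [CompleteSpace E] {P : Type*} [NormedAddCommGroup P]
    [NormedSpace ℝ P] {f : E → E} (hf : ContDiff ℝ ∞ f) {T : ℝ} {γ : ℝ → P → E}
    (h0 : ContDiff ℝ ∞ (γ 0))
    (hγ : ∀ q t, |t| < T → HasDerivAt (fun s => γ s q) (f (γ t q)) t)
    {t : ℝ} (ht : |t| < T) (q : P) :
    ContDiffAt ℝ ∞ (fun z : ℝ × P => γ z.1 z.2) (t, q) := by
  rw [contDiffAt_infty]
  intro m
  -- The order is kept finite because being `Cⁿ` at a point then persists at nearby points, as is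
  -- needed for the local flow. The implicit function theorem requires `n ≥ 1`.
  suffices h : ∀ n : ℕ, 1 ≤ n → ContDiffAt ℝ n (fun z : ℝ × P => γ z.1 z.2) (t, q) from
    (h (m + 1) (by omega)).of_le (by exact_mod_cast Nat.le_succ m)
  intro n hn
  have hfn : ContDiff ℝ n f := hf.of_le (by exact_mod_cast le_top)
  let I : Set ℝ := Ioo (-T) T
  have hI : ∀ s, s ∈ I ↔ |s| < T := fun s => abs_lt.symm
  have hT : 0 < T := (abs_nonneg t).trans_lt ht
  -- Smoothness at a time close to `τ` propagates to all times close to `τ`.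
  have hstep : ∀ τ ∈ I, ∃ δ > 0, ∀ s ∈ I, |s - τ| < δ → ContDiffAt ℝ n (γ s) q →
      ∀ r ∈ I, |r - τ| < δ → ContDiffAt ℝ n (fun z : ℝ × P => γ z.1 z.2) (r, q) := by
    intro τ hτ
    obtain ⟨Φ, hΦ, hflow⟩ := exists_contDiffAt_localFlow hn hfn (γ τ q)
    have hev := hflow.and (hΦ.eventually (by exact_mod_cast ENat.natCast_ne_top n))
    obtain ⟨ρ, hρ, hball⟩ := Metric.eventually_nhds_iff_ball.1 hev
    have hcont : ContinuousAt (fun s => γ s q) τ := (hγ q τ ((hI τ).1 hτ)).continuousAt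
    obtain ⟨δ₁, hδ₁, hc⟩ := Metric.continuousAt_iff.1 hcont ρ hρ
    refine ⟨min δ₁ (ρ / 2), lt_min hδ₁ (by positivity), ?_⟩
    intro s hs hsτ hsm r hr hrτ
    have hsr : |r - s| < ρ := by
      have h1 := hsτ.trans_le (min_le_right _ _)
      have h2 := hrτ.trans_le (min_le_right _ _)
      have := abs_sub_le r τ s
      rw [abs_sub_comm τ s] at this
      linarith
    have hys : dist (γ s q) (γ τ q) < ρ := hc (hsτ.trans_le (min_le_left _ _))
    let W : ℝ × P → ℝ × E := fun z => (z.1 - s, γ s z.2)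
    have hW : ContDiffAt ℝ n W (r, q) :=
      (contDiffAt_fst.sub contDiffAt_const).prodMk
        (ContDiffAt.comp (g := γ s) (f := Prod.snd) (r, q) hsm contDiffAt_snd)
    have hWb : W (r, q) ∈ Metric.ball ((0 : ℝ), γ τ q) ρ := by
      rw [Metric.mem_ball, Prod.dist_eq]
      exact max_lt (by simpa [W, Real.dist_eq] using hsr) hys
    have hcomp : ContDiffAt ℝ n (fun z => Φ (W z)) (r, q) :=
      ContDiffAt.comp (g := Φ) (f := W) (r, q) (hball _ hWb).2 hW
    refine hcomp.congr_of_eventuallyEq ?_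
    have h1 : ∀ᶠ z : ℝ × P in 𝓝 (r, q), W z ∈ Metric.ball ((0 : ℝ), γ τ q) ρ :=
      hW.continuousAt (Metric.isOpen_ball.mem_nhds hWb)
    have h2 : ∀ᶠ z : ℝ × P in 𝓝 (r, q), z.1 ∈ I :=
      continuousAt_fst (isOpen_Ioo.mem_nhds hr)
    filter_upwards [h1, h2] with z hz hzI
    -- The field is autonomous, so the curve restarted at time `s` is again an integral curve. Hence
    -- `γ` is the local flow composed with `γ s`.
    have hcurve := (hball _ hz).1 (fun σ => γ (s + σ) z.2) (by simp [W]) (by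
      intro σ hσ
      have hmem : s + σ ∈ I := by
        have : s + σ ∈ uIcc s z.1 := by
          have h := (image_const_add_uIcc s 0 (z.1 - s)) ▸ mem_image_of_mem (fun x => s + x) hσ
          simpa using h
        exact (ordConnected_Ioo.uIcc_subset hs hzI) this
      exact (hγ z.2 (s + σ) ((hI _).1 hmem)).comp_const_add s σ)
    simpa [W] using hcurve
  let good : Set ℝ := {s | s ∈ I ∧ ContDiffAt ℝ n (fun z : ℝ × P => γ z.1 z.2) (s, q)}
  have hslice : ∀ s, ContDiffAt ℝ n (fun z : ℝ × P => γ z.1 z.2) (s, q) →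
      ContDiffAt ℝ n (γ s) q := fun s hs =>
    ContDiffAt.comp (g := fun z : ℝ × P => γ z.1 z.2) (f := fun q => (s, q)) q hs
      (contDiffAt_const.prodMk contDiffAt_id)
  -- Connectedness of the time interval: the good times form an open, relatively closed set
  -- containing `0`.
  have hsub : I ⊆ good := by
    refine isPreconnected_Ioo.subset_of_closure_inter_subset ?_ ?_ ?_
    · rw [isOpen_iff_mem_nhds]
      rintro s ⟨hsI, hs⟩
      obtain ⟨δ, hδ, h⟩ := hstep s hsI
      filter_upwards [isOpen_Ioo.mem_nhds hsI, Metric.ball_mem_nhds s hδ] with r hr hrs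
      exact ⟨hr, h s hsI (by simpa using hδ) (hslice s hs) r hr hrs⟩
    · have h0I : (0 : ℝ) ∈ I := by rw [hI]; simpa using hT
      obtain ⟨δ, hδ, h⟩ := hstep 0 h0I
      exact ⟨0, h0I, h0I, h 0 h0I (by simpa using hδ)
        ((h0.of_le (by exact_mod_cast le_top)).contDiffAt) 0 h0I (by simpa using hδ)⟩
    · rintro τ ⟨hτ, hτI⟩
      obtain ⟨δ, hδ, h⟩ := hstep τ hτI
      obtain ⟨s, hs, hsτ⟩ := Metric.mem_closure_iff.1 hτ δ hδ
      rw [dist_comm] at hsτ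
      exact ⟨hτI, h s hs.1 hsτ (hslice s hs.2) τ hτI (by simpa using hδ)⟩
  exact (hsub ((hI t).2 ht)).2

end Flow

/-! ### Calculus on the time slab -/

section Slab

variable {F : Type*} [NormedAddCommGroup F] [NormedSpace ℝ F] {T : ℝ}

theorem isOpen_slab (T : ℝ) : IsOpen (slab T) :=
  isOpen_lt (continuous_abs.comp continuous_fst) continuous_const

theorem ContDiffOn.contDiffAt_slab {g : SpaceTime → F} (hg : ContDiffOn ℝ ∞ g (slab T))
    {z : SpaceTime} (hz : z ∈ slab T) : ContDiffAt ℝ ∞ g z :=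
  hg.contDiffAt ((isOpen_slab T).mem_nhds hz)

theorem contDiffOn_slab_iff {g : SpaceTime → F} :
    ContDiffOn ℝ ∞ g (slab T) ↔ ∀ z ∈ slab T, ContDiffAt ℝ ∞ g z :=
  ⟨fun h _ hz => ContDiffOn.contDiffAt_slab h hz, fun h z hz => (h z hz).contDiffWithinAt⟩

theorem differentiableAt_of_slab {g : SpaceTime → F} (hg : ContDiffOn ℝ ∞ g (slab T))
    {z : SpaceTime} (hz : z ∈ slab T) : DifferentiableAt ℝ g z :=
  (ContDiffOn.contDiffAt_slab hg hz).differentiableAt (by simp)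

theorem contDiffOn_fderiv_apply {g : SpaceTime → F} (hg : ContDiffOn ℝ ∞ g (slab T))
    {w : SpaceTime → SpaceTime} (hw : ContDiffOn ℝ ∞ w (slab T)) :
    ContDiffOn ℝ ∞ (fun z => fderiv ℝ g z (w z)) (slab T) :=
  (hg.fderiv_of_isOpen (isOpen_slab T) (by simp)).clm_apply hw

theorem hasDerivAt_time_slice {g : SpaceTime → F} {L : SpaceTime →L[ℝ] F} {z : SpaceTime}
    (h : HasFDerivAt g L z) : HasDerivAt (fun s => g (s, z.2)) (L (1, 0)) z.1 := by
  have h1 : HasDerivAt (fun s : ℝ => (s, z.2)) ((1 : ℝ), (0 : Space)) z.1 :=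
    (hasDerivAt_id z.1).prodMk (hasDerivAt_const z.1 z.2)
  exact HasFDerivAt.comp_hasDerivAt (f := fun s : ℝ => (s, z.2)) z.1 h h1

theorem hasFDerivAt_space_slice {g : SpaceTime → F} {L : SpaceTime →L[ℝ] F} {z : SpaceTime}
    (h : HasFDerivAt g L z) :
    HasFDerivAt (fun y => g (z.1, y)) (L ∘L .inr ℝ ℝ Space) z.2 :=
  HasFDerivAt.comp (f := fun y => (z.1, y)) z.2 h (hasFDerivAt_prodMk_right z.1 z.2)

/-- Time and space derivatives commute. -/
theorem hasDerivAt_fderiv_space {g : SpaceTime → F} {z : SpaceTime} (hg : ContDiffAt ℝ ∞ g z)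
    (w : Space) :
    HasDerivAt (fun s => fderiv ℝ g (s, z.2) (0, w))
      (fderiv ℝ (fun y => fderiv ℝ g y (1, 0)) z (0, w)) z.1 := by
  have hD : DifferentiableAt ℝ (fderiv ℝ g) z :=
    (hg.fderiv_right (m := ∞) (by simp)).differentiableAt (by simp)
  have h1 : HasDerivAt (fun s => fderiv ℝ g (s, z.2)) (fderiv ℝ (fderiv ℝ g) z (1, 0)) z.1 :=
    hasDerivAt_time_slice hD.hasFDerivAt
  have h2 : fderiv ℝ (fun y => fderiv ℝ g y (1, 0)) z (0, w)
      = fderiv ℝ (fderiv ℝ g) z (0, w) (1, 0) := by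
    rw [(hD.hasFDerivAt.clm_apply (hasFDerivAt_const ((1 : ℝ), (0 : Space)) z)).fderiv]
    simp
  have hsymm := hg.isSymmSndFDerivAt (by simpa using ENat.LEInfty.out) (1, 0) (0, w)
  rw [h2, ← hsymm]
  simpa using h1.clm_apply (hasDerivAt_const z.1 ((0 : ℝ), w))

variable [CompleteSpace F]

theorem hasDerivAt_primitive {g : SpaceTime → F} (hg : ContDiffOn ℝ ∞ g (slab T))
    {z : SpaceTime} (hz : z ∈ slab T) :
    HasDerivAt (fun s => ∫ r in (0 : ℝ)..s, g (r, z.2)) (g z) z.1 := by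
  have hc : ContinuousOn (fun r : ℝ => g (r, z.2)) (Ioo (-T) T) :=
    hg.continuousOn.comp (by fun_prop) fun r hr => abs_lt.2 hr
  have hz' : z.1 ∈ Ioo (-T) T := abs_lt.1 hz
  have h0 : (0 : ℝ) ∈ Ioo (-T) T := abs_lt.1 (by
    simpa using (abs_nonneg z.1).trans_lt hz)
  refine intervalIntegral.integral_hasDerivAt_right
    ((hc.mono (ordConnected_Ioo.uIcc_subset h0 hz')).intervalIntegrable) ?_
    (hc.continuousAt (isOpen_Ioo.mem_nhds hz'))
  exact hc.stronglyMeasurableAtFilter isOpen_Ioo _ hz'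

/-- The primitive is the last component of an integral curve of the smooth field `(1, 0, g)`, so
smoothness in the parameter follows from `contDiffAt_integralCurves`. -/
theorem contDiff_primitive {g : SpaceTime → F} (hg : ContDiff ℝ ∞ g) :
    ContDiff ℝ ∞ (fun z : SpaceTime => ∫ r in (0 : ℝ)..z.1, g (r, z.2)) := by
  let f : ℝ × Space × F → ℝ × Space × F := fun w => (1, 0, g (w.1, w.2.1))
  have hf : ContDiff ℝ ∞ f := by fun_prop
  let γ : ℝ → Space → ℝ × Space × F := fun t q => (t, q, ∫ r in (0 : ℝ)..t, g (r, q))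
  have hγ0 : ContDiff ℝ ∞ (γ 0) := by
    have : γ 0 = fun q => (0, q, 0) := by funext q; simp [γ]
    rw [this]; fun_prop
  rw [contDiff_iff_contDiffAt]
  rintro ⟨t, q⟩
  have h := contDiffAt_integralCurves hf (T := |t| + 1) hγ0 (fun q' s hs => by
    have h1 := hasDerivAt_primitive (T := |t| + 1) hg.contDiffOn (z := (s, q')) hs
    exact (hasDerivAt_id s).prodMk ((hasDerivAt_const s q').prodMk h1)) (lt_add_one |t|) q
  exact h.snd.snd

/-- The time primitive of a smooth function on the slab is smooth. -/
theorem contDiffOn_primitive {g : SpaceTime → F} (hg : ContDiffOn ℝ ∞ g (slab T)) :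
    ContDiffOn ℝ ∞ (fun z : SpaceTime => ∫ r in (0 : ℝ)..z.1, g (r, z.2)) (slab T) := by
  rw [contDiffOn_slab_iff]
  intro z hz
  have hz' : |z.1| < T := hz
  have hz0 := abs_nonneg z.1
  -- Nothing is known about `g` off the slab. The two radii trisect the interval from `|z.1|` to
  -- `T`, so `χ g` is globally smooth and has the same primitive near `z`.
  let χ : ContDiffBump (0 : ℝ) := ⟨(2 * |z.1| + T) / 3, (|z.1| + 2 * T) / 3, by linarith,
    by linarith⟩
  have hχ : ContDiff ℝ ∞ (fun w : SpaceTime => χ w.1 • g w) := by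
    rw [contDiff_iff_contDiffAt]
    intro w
    by_cases hw : w ∈ slab T
    · exact (χ.contDiff.contDiffAt.comp w contDiffAt_fst).smul (ContDiffOn.contDiffAt_slab hg hw)
    · have hw' : w.1 ∉ tsupport χ := by
        rw [χ.tsupport_eq, Metric.mem_closedBall, Real.dist_eq, sub_zero, not_le]
        have : T ≤ |w.1| := not_lt.1 hw
        change (|z.1| + 2 * T) / 3 < _
        linarith
      have hev : ∀ᶠ v : SpaceTime in 𝓝 w, v.1 ∉ tsupport χ :=
        continuousAt_fst ((isClosed_tsupport χ).isOpen_compl.mem_nhds hw')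
      refine (contDiffAt_const (c := (0 : F))).congr_of_eventuallyEq ?_
      filter_upwards [hev] with v hv
      rw [image_eq_zero_of_notMem_tsupport hv, zero_smul]
  refine (contDiff_primitive hχ).contDiffAt.congr_of_eventuallyEq ?_
  have hev : ∀ᶠ v : SpaceTime in 𝓝 z, |v.1| < (2 * |z.1| + T) / 3 :=
    (continuous_abs.comp continuous_fst).continuousAt
      (isOpen_Iio.mem_nhds (show |z.1| < _ by linarith))
  filter_upwards [hev] with v hv
  refine intervalIntegral.integral_congr fun r hr => ?_
  have hrv : |r| ≤ |v.1| := by simpa using abs_sub_left_of_mem_uIcc hr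
  have : χ r = 1 := χ.one_of_mem_closedBall (by
    rw [Metric.mem_closedBall, Real.dist_eq, sub_zero]
    exact hrv.trans hv.le)
  simp [this]

end Slab

/-! ### The rays as a smooth change of coordinates on the slab -/

section Flow

variable {T : ℝ} {x : ℝ → Space → Space}

/-- `x t` is, for `|t| < T`, a family of diffeomorphisms depending smoothly on `t`. -/
structure IsRegularFlow (T : ℝ) (x : ℝ → Space → Space) : Prop where
  smooth : ContDiffOn ℝ ∞ (fun z : SpaceTime => x z.1 z.2) (slab T)
  bijective : ∀ t, |t| < T → Function.Bijective (x t)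
  fderiv_injective : ∀ t, |t| < T → ∀ q, Function.Injective (fderiv ℝ (x t) q)

/-- The map `(t, q) ↦ (t, x(t, q))`. -/
def rayMap (x : ℝ → Space → Space) (z : SpaceTime) : SpaceTime := (z.1, x z.1 z.2)

/-- The inverse of `rayMap`. -/
def rayInv (x : ℝ → Space → Space) (z : SpaceTime) : SpaceTime :=
  (z.1, Function.invFun (x z.1) z.2)

theorem rayMap_mem {z : SpaceTime} : rayMap x z ∈ slab T ↔ z ∈ slab T := Iff.rfl

theorem rayInv_mem {z : SpaceTime} : rayInv x z ∈ slab T ↔ z ∈ slab T := Iff.rfl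

namespace IsRegularFlow

variable (hx : IsRegularFlow T x)

include hx

theorem rayMap_rayInv {z : SpaceTime} (hz : z ∈ slab T) : rayMap x (rayInv x z) = z :=
  Prod.ext rfl (Function.rightInverse_invFun (hx.bijective z.1 hz).2 z.2)

theorem rayInv_rayMap {z : SpaceTime} (hz : z ∈ slab T) : rayInv x (rayMap x z) = z :=
  Prod.ext rfl (Function.leftInverse_invFun (hx.bijective z.1 hz).1 z.2)

theorem contDiffOn_rayMap : ContDiffOn ℝ ∞ (rayMap x) (slab T) :=
  contDiffOn_fst.prodMk hx.smooth

theorem fderiv_slice {z : SpaceTime} (hz : z ∈ slab T) (w : Space) :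
    fderiv ℝ (fun z : SpaceTime => x z.1 z.2) z (0, w) = fderiv ℝ (x z.1) z.2 w := by
  have h := hasFDerivAt_space_slice (differentiableAt_of_slab hx.smooth hz).hasFDerivAt
  rw [show fderiv ℝ (x z.1) z.2 = _ from h.fderiv]
  simp

theorem fderiv_rayMap {z : SpaceTime} (hz : z ∈ slab T) (v : SpaceTime) :
    fderiv ℝ (rayMap x) z v = (v.1, fderiv ℝ (fun z : SpaceTime => x z.1 z.2) z v) := by
  have h := hasFDerivAt_fst.prodMk (differentiableAt_of_slab hx.smooth hz).hasFDerivAt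
  rw [show fderiv ℝ (rayMap x) z = _ from h.fderiv]
  simp

theorem exists_fderiv_space_eq {z : SpaceTime} (hz : z ∈ slab T) (v : Space) :
    ∃ w, fderiv ℝ (fun z : SpaceTime => x z.1 z.2) z (0, w) = v := by
  obtain ⟨w, hw⟩ := LinearMap.injective_iff_surjective.1
    (show Function.Injective (fderiv ℝ (x z.1) z.2 : Space →ₗ[ℝ] Space) from
      hx.fderiv_injective z.1 hz z.2) v
  exact ⟨w, (hx.fderiv_slice hz w).trans hw⟩

theorem fderiv_rayMap_injective {z : SpaceTime} (hz : z ∈ slab T) :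
    Function.Injective (fderiv ℝ (rayMap x) z) := by
  rw [injective_iff_map_eq_zero]
  rintro ⟨τ, w⟩ h
  rw [hx.fderiv_rayMap hz] at h
  obtain rfl : τ = 0 := congrArg Prod.fst h
  have h2 : fderiv ℝ (fun z : SpaceTime => x z.1 z.2) z (0, w) = 0 := congrArg Prod.snd h
  rw [hx.fderiv_slice hz] at h2
  have := (injective_iff_map_eq_zero _).1 (hx.fderiv_injective z.1 hz z.2) w h2
  rw [this]; rfl

/-- Inverting each `x t` separately says nothing about smoothness in `t`. The inverse function
theorem is therefore applied in space-time to `rayMap`, and global injectivity identifies the local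
inverse with `rayInv`. -/
theorem contDiffOn_rayInv : ContDiffOn ℝ ∞ (rayInv x) (slab T) := by
  rw [contDiffOn_slab_iff]
  intro z hz
  let q := rayInv x z
  have hq : q ∈ slab T := hz
  have hqz : rayMap x q = z := hx.rayMap_rayInv hz
  let L : SpaceTime ≃L[ℝ] SpaceTime :=
    (LinearEquiv.ofInjectiveEndo (fderiv ℝ (rayMap x) q : SpaceTime →ₗ[ℝ] SpaceTime)
      (hx.fderiv_rayMap_injective hq)).toContinuousLinearEquiv
  have hΨ := ContDiffOn.contDiffAt_slab hx.contDiffOn_rayMap hq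
  have hL : HasFDerivAt (rayMap x) (L : SpaceTime →L[ℝ] SpaceTime) q := by
    have : (L : SpaceTime →L[ℝ] SpaceTime) = fderiv ℝ (rayMap x) q := by ext v <;> rfl
    rw [this]
    exact (hΨ.differentiableAt (by simp)).hasFDerivAt
  have hinv := hΨ.to_localInverse hL (by simp)
  have hright := (hΨ.hasStrictFDerivAt' hL (by simp)).eventually_right_inverse
  rw [hqz] at hinv hright
  refine hinv.congr_of_eventuallyEq ?_
  filter_upwards [hright, (isOpen_slab T).mem_nhds hz] with y hy hyT
  have hmem : hΨ.localInverse hL (by simp) y ∈ slab T := by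
    rw [← rayMap_mem (x := x)]
    exact hy.symm ▸ hyT
  rw [← hx.rayInv_rayMap hmem]
  exact congrArg (rayInv x) hy.symm

/-- A smooth function of `(t, q)`, transported to `(t, y)` with `y = x(t, q)`. -/
theorem contDiffOn_comp_rayInv {F : Type*} [NormedAddCommGroup F] [NormedSpace ℝ F]
    {g : SpaceTime → F} (hg : ContDiffOn ℝ ∞ g (slab T)) :
    ContDiffOn ℝ ∞ (fun z => g (rayInv x z)) (slab T) :=
  hg.comp hx.contDiffOn_rayInv fun _ hz => hz

theorem contDiffOn_comp_rayMap {F : Type*} [NormedAddCommGroup F] [NormedSpace ℝ F]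
    {g : SpaceTime → F} (hg : ContDiffOn ℝ ∞ g (slab T)) :
    ContDiffOn ℝ ∞ (fun z => g (rayMap x z)) (slab T) :=
  hg.comp hx.contDiffOn_rayMap fun _ hz => hz

/-- Chain rule for `g = (g ∘ rayInv) ∘ rayMap`; it avoids computing the derivative of the inverse.
-/
theorem fderiv_comp_rayInv {F : Type*} [NormedAddCommGroup F] [NormedSpace ℝ F]
    {g : SpaceTime → F} (hg : ContDiffOn ℝ ∞ g (slab T)) {z : SpaceTime} (hz : z ∈ slab T)
    (v : SpaceTime) :
    fderiv ℝ (fun y => g (rayInv x y)) (rayMap x z)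
      (v.1, fderiv ℝ (fun z : SpaceTime => x z.1 z.2) z v) = fderiv ℝ g z v := by
  have h1 := (differentiableAt_of_slab (hx.contDiffOn_comp_rayInv hg)
    (rayMap_mem.2 hz)).hasFDerivAt.comp z
    (differentiableAt_of_slab hx.contDiffOn_rayMap hz).hasFDerivAt
  have h2 : HasFDerivAt g _ z := h1.congr_of_eventuallyEq (by
    filter_upwards [(isOpen_slab T).mem_nhds hz] with y hy
    simp [hx.rayInv_rayMap hy])
  rw [h2.fderiv, ← hx.fderiv_rayMap hz]
  rfl

end IsRegularFlow

end Flow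

/-! ### The action along the rays and the Hamilton-Jacobi equation -/

section Phase

/-- The gradient of `H(t, y, p)` with respect to the momentum `p`. -/
def momentumGradient (H : ℝ × Space × Space → ℝ) (w : ℝ × Space × Space) : Space :=
  ∇ (fun q : Space => H (w.1, w.2.1, q)) w.2.2

/-- The gradient of `H(t, y, p)` with respect to the position `y`. -/
def positionGradient (H : ℝ × Space × Space → ℝ) (w : ℝ × Space × Space) : Space :=
  ∇ (fun y : Space => H (w.1, y, w.2.2)) w.2.1

variable {H : ℝ × Space × Space → ℝ}

theorem momentumGradient_eq (hH : ContDiff ℝ ∞ H) (w : ℝ × Space × Space) :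
    momentumGradient H w = (InnerProductSpace.toDual ℝ Space).symm
      (fderiv ℝ H w ∘L (.inr ℝ ℝ (Space × Space) ∘L .inr ℝ Space Space)) := by
  have h : HasFDerivAt (fun q : Space => H (w.1, w.2.1, q))
      (fderiv ℝ H w ∘L (.inr ℝ ℝ (Space × Space) ∘L .inr ℝ Space Space)) w.2.2 :=
    HasFDerivAt.comp (f := fun q : Space => (w.1, w.2.1, q)) w.2.2
      (hH.differentiable (by simp) w).hasFDerivAt
      ((hasFDerivAt_prodMk_right w.1 w.2).comp w.2.2 (hasFDerivAt_prodMk_right w.2.1 w.2.2))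
  rw [momentumGradient, gradient, h.fderiv]

theorem positionGradient_eq (hH : ContDiff ℝ ∞ H) (w : ℝ × Space × Space) :
    positionGradient H w = (InnerProductSpace.toDual ℝ Space).symm
      (fderiv ℝ H w ∘L (.inr ℝ ℝ (Space × Space) ∘L .inl ℝ Space Space)) := by
  have h : HasFDerivAt (fun y : Space => H (w.1, y, w.2.2))
      (fderiv ℝ H w ∘L (.inr ℝ ℝ (Space × Space) ∘L .inl ℝ Space Space)) w.2.1 :=
    HasFDerivAt.comp (f := fun y : Space => (w.1, y, w.2.2)) w.2.1
      (hH.differentiable (by simp) w).hasFDerivAt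
      ((hasFDerivAt_prodMk_right w.1 w.2).comp w.2.1 (hasFDerivAt_prodMk_left w.2.1 w.2.2))
  rw [positionGradient, gradient, h.fderiv]

theorem inner_momentumGradient (hH : ContDiff ℝ ∞ H) (w : ℝ × Space × Space) (v : Space) :
    inner ℝ (momentumGradient H w) v = fderiv ℝ H w (0, 0, v) := by
  rw [momentumGradient_eq hH, InnerProductSpace.toDual_symm_apply]
  simp

theorem inner_positionGradient (hH : ContDiff ℝ ∞ H) (w : ℝ × Space × Space) (v : Space) :
    inner ℝ (positionGradient H w) v = fderiv ℝ H w (0, v, 0) := by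
  rw [positionGradient_eq hH, InnerProductSpace.toDual_symm_apply]
  simp

theorem contDiff_momentumGradient (hH : ContDiff ℝ ∞ H) :
    ContDiff ℝ ∞ (momentumGradient H) := by
  rw [funext (momentumGradient_eq hH)]
  exact (InnerProductSpace.toDual ℝ Space).symm.contDiff.comp
    ((hH.fderiv_right (by simp)).clm_comp contDiff_const)

theorem contDiff_positionGradient (hH : ContDiff ℝ ∞ H) :
    ContDiff ℝ ∞ (positionGradient H) := by
  rw [funext (positionGradient_eq hH)]
  exact (InnerProductSpace.toDual ℝ Space).symm.contDiff.comp
    ((hH.fderiv_right (by simp)).clm_comp contDiff_const)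

theorem contDiff_gradient {S₀ : Space → ℝ} (hS₀ : ContDiff ℝ ∞ S₀) : ContDiff ℝ ∞ (∇ S₀) :=
  (InnerProductSpace.toDual ℝ Space).symm.contDiff.comp (hS₀.fderiv_right (by simp))

/-- The rays `(x, p)` starting at `(q, ∇S₀(q))` solve the Hamilton system of `H` for `|t| < T`. -/
structure IsHamiltonFlow (H : ℝ × Space × Space → ℝ) (S₀ : Space → ℝ) (T : ℝ)
    (x p : ℝ → Space → Space) : Prop where
  x_zero : ∀ q, x 0 q = q
  p_zero : ∀ q, p 0 q = ∇ S₀ q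
  x_eq : ∀ q t, |t| < T → HasDerivAt (fun s => x s q) (momentumGradient H (t, x t q, p t q)) t
  p_eq : ∀ q t, |t| < T → HasDerivAt (fun s => p s q) (-positionGradient H (t, x t q, p t q)) t

namespace IsHamiltonFlow

variable {S₀ : Space → ℝ} {T : ℝ} {x p : ℝ → Space → Space} (hxp : IsHamiltonFlow H S₀ T x p)
  (hH : ContDiff ℝ ∞ H) (hS₀ : ContDiff ℝ ∞ S₀)

include hxp hH hS₀

/-- Adjoining `t` as a coordinate of speed `1` makes the Hamilton system autonomous. -/
theorem contDiffOn_ray : ContDiffOn ℝ ∞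
    (fun z : SpaceTime => ((z.1, x z.1 z.2, p z.1 z.2) : ℝ × Space × Space)) (slab T) := by
  rw [contDiffOn_slab_iff]
  intro z hz
  have hf : ContDiff ℝ ∞ (fun w : ℝ × Space × Space =>
      ((1 : ℝ), momentumGradient H w, -positionGradient H w)) :=
    contDiff_const.prodMk ((contDiff_momentumGradient hH).prodMk
      (contDiff_positionGradient hH).neg)
  refine contDiffAt_integralCurves hf (γ := fun t q => (t, x t q, p t q)) (T := T) ?_ ?_ hz z.2
  · rw [show (fun q => ((0 : ℝ), x 0 q, p 0 q)) = fun q => ((0 : ℝ), q, ∇ S₀ q) by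
      funext q; rw [hxp.x_zero, hxp.p_zero]]
    exact contDiff_const.prodMk (contDiff_id.prodMk (contDiff_gradient hS₀))
  · exact fun q t ht => (hasDerivAt_id t).prodMk ((hxp.x_eq q t ht).prodMk (hxp.p_eq q t ht))

theorem contDiffOn_x : ContDiffOn ℝ ∞ (fun z : SpaceTime => x z.1 z.2) (slab T) :=
  (hxp.contDiffOn_ray hH hS₀).snd.fst

theorem contDiffOn_p : ContDiffOn ℝ ∞ (fun z : SpaceTime => p z.1 z.2) (slab T) :=
  (hxp.contDiffOn_ray hH hS₀).snd.snd

theorem fderiv_x_time {z : SpaceTime} (hz : z ∈ slab T) :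
    fderiv ℝ (fun z : SpaceTime => x z.1 z.2) z (1, 0)
      = momentumGradient H (z.1, x z.1 z.2, p z.1 z.2) :=
  (hasDerivAt_time_slice (differentiableAt_of_slab (hxp.contDiffOn_x hH hS₀) hz).hasFDerivAt).unique
    (hxp.x_eq z.2 z.1 hz)

/-- Along the rays, the action `s(t, q) = S₀(q) + ∫₀ᵗ (⟨p, H_p⟩ - H)` satisfies
`ds = ⟨p, dx⟩ - H dt`. -/
theorem exists_action : ∃ s : SpaceTime → ℝ, ContDiffOn ℝ ∞ s (slab T) ∧
    (∀ q, s (0, q) = S₀ q) ∧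
    (∀ z ∈ slab T, ∀ w, fderiv ℝ s z (0, w)
      = inner ℝ (p z.1 z.2) (fderiv ℝ (fun z : SpaceTime => x z.1 z.2) z (0, w))) ∧
    ∀ z ∈ slab T, fderiv ℝ s z (1, 0)
      = inner ℝ (p z.1 z.2) (fderiv ℝ (fun z : SpaceTime => x z.1 z.2) z (1, 0))
        - H (z.1, x z.1 z.2, p z.1 z.2) := by
  have hX := hxp.contDiffOn_x hH hS₀
  have hP := hxp.contDiffOn_p hH hS₀
  have hR := hxp.contDiffOn_ray hH hS₀
  let X : SpaceTime → Space := fun z => x z.1 z.2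
  let P : SpaceTime → Space := fun z => p z.1 z.2
  let R : SpaceTime → ℝ × Space × Space := fun z => (z.1, X z, P z)
  let V : SpaceTime → Space := fun z => fderiv ℝ X z (1, 0)
  let ℓ : SpaceTime → ℝ := fun z => inner ℝ (P z) (V z) - H (R z)
  have hV : ContDiffOn ℝ ∞ V (slab T) := contDiffOn_fderiv_apply hX contDiffOn_const
  have hHR : ContDiffOn ℝ ∞ (fun z => H (R z)) (slab T) := hH.comp_contDiffOn hR
  have hℓ : ContDiffOn ℝ ∞ ℓ (slab T) := (hP.inner ℝ hV).sub hHR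
  let s : SpaceTime → ℝ := fun z => S₀ z.2 + ∫ r in (0 : ℝ)..z.1, ℓ (r, z.2)
  have hs : ContDiffOn ℝ ∞ s (slab T) :=
    (hS₀.comp contDiff_snd).contDiffOn.add (contDiffOn_primitive hℓ)
  have hs0 : ∀ q, s (0, q) = S₀ q := fun q => by simp [s]
  have hst : ∀ z ∈ slab T, fderiv ℝ s z (1, 0) = ℓ z := fun z hz =>
    (hasDerivAt_time_slice (differentiableAt_of_slab hs hz).hasFDerivAt).unique
      ((hasDerivAt_primitive hℓ hz).const_add (S₀ z.2))
  -- The variation of `p` contributes `⟨∂_w p, ẋ - H_p⟩`, which vanishes by the first Hamilton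
  -- equation.
  have hℓw : ∀ z ∈ slab T, ∀ w, fderiv ℝ ℓ z (0, w)
      = inner ℝ (P z) (fderiv ℝ V z (0, w))
        - inner ℝ (positionGradient H (R z)) (fderiv ℝ X z (0, w)) := by
    intro z hz w
    have hXd := (differentiableAt_of_slab hX hz).hasFDerivAt
    have hPd := (differentiableAt_of_slab hP hz).hasFDerivAt
    have hVd := (differentiableAt_of_slab hV hz).hasFDerivAt
    have h1 := hPd.inner ℝ hVd
    have h2 : HasFDerivAt (fun z => H (R z)) _ z :=
      HasFDerivAt.comp (f := R) z (hH.differentiable (by simp) (R z)).hasFDerivAt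
        (hasFDerivAt_fst.prodMk (hXd.prodMk hPd))
    have h3 : HasFDerivAt ℓ _ z := h1.sub h2
    rw [h3.fderiv]
    have hsplit : (((0 : ℝ), fderiv ℝ X z (0, w), fderiv ℝ P z (0, w)) : ℝ × Space × Space)
        = (0, fderiv ℝ X z (0, w), 0) + (0, 0, fderiv ℝ P z (0, w)) := by simp
    have hVz : V z = momentumGradient H (R z) := hxp.fderiv_x_time hH hS₀ hz
    have h4 : fderiv ℝ H (R z) (0, fderiv ℝ X z (0, w), fderiv ℝ P z (0, w))
        = inner ℝ (positionGradient H (R z)) (fderiv ℝ X z (0, w))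
          + inner ℝ (V z) (fderiv ℝ P z (0, w)) := by
      rw [hsplit, map_add, inner_positionGradient hH, hVz, inner_momentumGradient hH]
    have h5 : inner ℝ (fderiv ℝ P z (0, w)) (V z) = inner ℝ (V z) (fderiv ℝ P z (0, w)) :=
      real_inner_comm _ _
    change (inner ℝ (P z) (fderiv ℝ V z (0, w)) + inner ℝ (fderiv ℝ P z (0, w)) (V z))
      - fderiv ℝ H (R z) (0, fderiv ℝ X z (0, w), fderiv ℝ P z (0, w)) = _
    rw [h4, h5]
    ring
  refine ⟨s, hs, hs0, ?_, hst⟩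
  intro z hz w
  -- The defect in `∂_w s = ⟨p, ∂_w x⟩` is constant in time by `ṗ = -H_x` and the symmetry of second
  -- derivatives. It vanishes at `t = 0`, where `x` is the identity and `p = ∇S₀`.
  let D : ℝ → ℝ := fun t => fderiv ℝ s (t, z.2) (0, w) - inner ℝ (P (t, z.2))
    (fderiv ℝ X (t, z.2) (0, w))
  have hD : ∀ t ∈ Ioo (-T) T, HasDerivAt D 0 t := by
    intro t ht
    have hmem : (t, z.2) ∈ slab T := abs_lt.2 ht
    have h1 := hasDerivAt_fderiv_space (ContDiffOn.contDiffAt_slab hs hmem) w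
    have h2 := hasDerivAt_fderiv_space (ContDiffOn.contDiffAt_slab hX hmem) w
    have h3 : HasDerivAt (fun t => P (t, z.2)) (-positionGradient H (R (t, z.2))) t :=
      hxp.p_eq z.2 t (abs_lt.2 ht)
    have h4 : fderiv ℝ (fun y => fderiv ℝ s y (1, 0)) (t, z.2) = fderiv ℝ ℓ (t, z.2) := by
      refine Filter.EventuallyEq.fderiv_eq ?_
      filter_upwards [(isOpen_slab T).mem_nhds hmem] with y hy
      exact hst y hy
    have h5 := h1.sub (h3.inner ℝ h2)
    refine h5.congr_deriv ?_
    rw [h4, hℓw _ hmem, inner_neg_left]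
    change _ - (inner ℝ (P (t, z.2)) (fderiv ℝ V (t, z.2) (0, w)) + _) = _
    ring
  have hT : (0 : ℝ) ∈ Ioo (-T) T := abs_lt.1 (by simpa using (abs_nonneg z.1).trans_lt hz)
  have hconst : D z.1 = D 0 := by
    refine isOpen_Ioo.is_const_of_deriv_eq_zero isPreconnected_Ioo
      (fun t ht => (hD t ht).differentiableAt.differentiableWithinAt)
      (fun t ht => (hD t ht).deriv) (abs_lt.1 hz) hT
  have hz0 : ((0 : ℝ), z.2) ∈ slab T := abs_lt.2 hT
  have hD0 : D 0 = 0 := by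
    have h1 := (hasFDerivAt_space_slice (differentiableAt_of_slab hs hz0).hasFDerivAt).fderiv
    have h3 : (fun y => s (0, y)) = S₀ := funext hs0
    have h4 : (fun y => X (0, y)) = fun y => y := funext hxp.x_zero
    have h2 : fderiv ℝ (fun y : Space => y) z.2 = fderiv ℝ X (0, z.2) ∘L .inr ℝ ℝ Space := by
      rw [← h4]
      exact (hasFDerivAt_space_slice (differentiableAt_of_slab hX hz0).hasFDerivAt).fderiv
    simp only [h3] at h1
    have h5 : fderiv ℝ s (0, z.2) (0, w) = fderiv ℝ S₀ z.2 w := by rw [h1]; simp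
    have h6 : fderiv ℝ X (0, z.2) (0, w) = w := by
      have := DFunLike.congr_fun h2 w
      simpa using this.symm
    have h7 : P (0, z.2) = ∇ S₀ z.2 := hxp.p_zero z.2
    simp only [D]
    rw [h5, h6, h7, gradient, InnerProductSpace.toDual_symm_apply, sub_self]
  exact sub_eq_zero.1 (hconst.trans hD0)

/-- The phase function: a solution of the Hamilton-Jacobi equation with `∇S = p` on the rays. -/
theorem exists_phase (hx : IsRegularFlow T x) (hT : 0 < T) : ∃ (S : SpaceTime → ℝ)
    (P : SpaceTime → Space),
    ContDiffOn ℝ ∞ S (slab T) ∧ ContDiffOn ℝ ∞ P (slab T) ∧ (∀ y, S (0, y) = S₀ y) ∧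
    (∀ z ∈ slab T, P (rayMap x z) = p z.1 z.2) ∧
    ∀ z ∈ slab T, (∀ v, fderiv ℝ S z (0, v) = inner ℝ (P z) v) ∧
      fderiv ℝ S z (1, 0) = -H (z.1, z.2, P z) := by
  obtain ⟨s, hs, hs0, hsw, hst⟩ := hxp.exists_action hH hS₀
  refine ⟨fun z => s (rayInv x z), fun z => p (rayInv x z).1 (rayInv x z).2,
    hx.contDiffOn_comp_rayInv hs, hx.contDiffOn_comp_rayInv (hxp.contDiffOn_p hH hS₀), ?_, ?_, ?_⟩
  · intro y
    have h0 : ((0 : ℝ), y) ∈ slab T := by simpa [slab] using hT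
    have : rayMap x (0, y) = (0, y) := Prod.ext rfl (hxp.x_zero y)
    have h1 := hx.rayInv_rayMap h0
    rw [this] at h1
    beta_reduce
    rw [h1, hs0]
  · intro z hz
    beta_reduce
    rw [hx.rayInv_rayMap hz]
  · intro y hy
    obtain ⟨z, hz, rfl⟩ : ∃ z ∈ slab T, rayMap x z = y :=
      ⟨rayInv x y, hy, hx.rayMap_rayInv hy⟩
    beta_reduce
    rw [hx.rayInv_rayMap hz]
    have hspace : ∀ v, fderiv ℝ (fun y => s (rayInv x y)) (rayMap x z) (0, v)
        = inner ℝ (p z.1 z.2) v := by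
      intro v
      obtain ⟨w, rfl⟩ := hx.exists_fderiv_space_eq hz v
      rw [← hsw z hz w]
      exact hx.fderiv_comp_rayInv hs hz (0, w)
    refine ⟨hspace, ?_⟩
    have h1 := hx.fderiv_comp_rayInv hs hz (1, 0)
    -- The derivative along a ray is `∂_t S + ⟨∇S, ẋ⟩`. Its second term cancels `⟨p, ẋ⟩` in the
    -- action.
    have hsplit : (((1 : ℝ), fderiv ℝ (fun z : SpaceTime => x z.1 z.2) z (1, 0)) : SpaceTime)
        = (1, 0) + (0, fderiv ℝ (fun z : SpaceTime => x z.1 z.2) z (1, 0)) := by simp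
    rw [hsplit, map_add, hspace, hst z hz] at h1
    change _ = -H (z.1, x z.1 z.2, p z.1 z.2)
    linarith

end IsHamiltonFlow

end Phase

/-! ### The transport equation as a linear ODE on each ray -/

/-- The transport equation along a regular flow with velocity field `U` is solvable by smooth
functions, and the solution vanishes along a ray if its data do. -/
theorem exists_transport {T : ℝ} (hT : 0 < T) {x : ℝ → Space → Space} (hx : IsRegularFlow T x)
    (hx0 : ∀ q, x 0 q = q) {U : SpaceTime → Space}
    (hU : ∀ z ∈ slab T, fderiv ℝ (fun z : SpaceTime => x z.1 z.2) z (1, 0) = U (rayMap x z))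
    {d : SpaceTime → ℂ} (hd : ContDiffOn ℝ ∞ d (slab T))
    {F : SpaceTime → ℂ} (hF : ContDiffOn ℝ ∞ F (slab T))
    {b₀ : Space → ℂ} (hb₀ : ContDiff ℝ ∞ b₀) :
    ∃ a : SpaceTime → ℂ, ContDiffOn ℝ ∞ a (slab T) ∧ (∀ y, a (0, y) = b₀ y) ∧
      (∀ z ∈ slab T, fderiv ℝ a z (1, U z) + d z * a z = F z) ∧
      ∀ q, b₀ q = 0 → (∀ t, |t| < T → F (t, x t q) = 0) → ∀ t, |t| < T → a (t, x t q) = 0 := by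
  let dr : SpaceTime → ℂ := fun z => d (rayMap x z)
  have hdr : ContDiffOn ℝ ∞ dr (slab T) := hx.contDiffOn_comp_rayMap hd
  let B : SpaceTime → ℂ := fun z => ∫ r in (0 : ℝ)..z.1, dr (r, z.2)
  have hB : ContDiffOn ℝ ∞ B (slab T) := contDiffOn_primitive hdr
  let g : SpaceTime → ℂ := fun z => Complex.exp (B z) * F (rayMap x z)
  have hg : ContDiffOn ℝ ∞ g (slab T) := hB.cexp.mul (hx.contDiffOn_comp_rayMap hF)
  -- Variation of constants for `b' + d b = F` in ray coordinates, with integrating factor `e^B`.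
  let b : SpaceTime → ℂ := fun z =>
    Complex.exp (-B z) * (b₀ z.2 + ∫ r in (0 : ℝ)..z.1, g (r, z.2))
  have hb : ContDiffOn ℝ ∞ b (slab T) := hB.neg.cexp.mul
    ((hb₀.comp contDiff_snd).contDiffOn.add (contDiffOn_primitive hg))
  have hbt : ∀ z ∈ slab T, fderiv ℝ b z (1, 0) = F (rayMap x z) - dr z * b z := by
    intro z hz
    have h1 : HasDerivAt (fun s => Complex.exp (-B (s, z.2)))
        (Complex.exp (-B z) * -dr z) z.1 := (hasDerivAt_primitive hdr hz).neg.cexp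
    have h2 := h1.mul ((hasDerivAt_primitive hg hz).const_add (b₀ z.2))
    have h3 : fderiv ℝ b z (1, 0) = _ :=
      (hasDerivAt_time_slice (differentiableAt_of_slab hb hz).hasFDerivAt).unique h2
    rw [h3]
    have h4 : Complex.exp (-B z) * Complex.exp (B z) = 1 := by
      rw [← Complex.exp_add, neg_add_cancel, Complex.exp_zero]
    change Complex.exp (-B z) * -dr z * (b₀ z.2 + ∫ r in (0 : ℝ)..z.1, g (r, z.2))
      + Complex.exp (-B z) * (Complex.exp (B z) * F (rayMap x z)) = _
    rw [← mul_assoc (Complex.exp (-B z)) (Complex.exp (B z)), h4]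
    simp only [b]
    ring
  refine ⟨fun z => b (rayInv x z), hx.contDiffOn_comp_rayInv hb, ?_, ?_, ?_⟩
  · intro y
    have h0 : ((0 : ℝ), y) ∈ slab T := by simpa [slab] using hT
    have h1 := hx.rayInv_rayMap h0
    rw [show rayMap x (0, y) = (0, y) from Prod.ext rfl (hx0 y)] at h1
    simp [h1, b, B]
  · intro y hy
    obtain ⟨z, hz, rfl⟩ : ∃ z ∈ slab T, rayMap x z = y :=
      ⟨rayInv x y, hy, hx.rayMap_rayInv hy⟩
    have h1 := hx.fderiv_comp_rayInv hb hz (1, 0)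
    rw [hU z hz, hbt z hz] at h1
    beta_reduce
    rw [h1, hx.rayInv_rayMap hz]
    simp [dr]
  · intro q hq hFq t ht
    have hz : (t, q) ∈ slab T := ht
    have h1 : rayInv x (t, x t q) = (t, q) := hx.rayInv_rayMap hz
    have h2 : ∫ r in (0 : ℝ)..t, g (r, q) = 0 := by
      rw [intervalIntegral.integral_congr (g := fun _ => (0 : ℂ)), intervalIntegral.integral_zero]
      intro r hr
      have hrt : |r| ≤ |t| := by simpa using abs_sub_left_of_mem_uIcc hr
      have : F (rayMap x (r, q)) = 0 := hFq r (hrt.trans_lt ht)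
      simp [g, this]
    simp only [h1, b, hq, h2, add_zero, mul_zero]

/-! ### Differentiating an amplitude times an oscillating factor -/

section Wave

/-- The `j`-th spatial derivative of a function on space-time. -/
def partialDeriv (j : Fin 3) (a : SpaceTime → ℂ) (z : SpaceTime) : ℂ :=
  fderiv ℝ a z (0, EuclideanSpace.single j 1)

/-- The spatial Laplacian of a function on space-time. -/
def spaceLaplacian (a : SpaceTime → ℂ) (z : SpaceTime) : ℂ :=
  ∑ j : Fin 3, partialDeriv j (partialDeriv j a) z

variable {T : ℝ}

theorem contDiffOn_partialDeriv {a : SpaceTime → ℂ} (ha : ContDiffOn ℝ ∞ a (slab T)) (j : Fin 3) :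
    ContDiffOn ℝ ∞ (partialDeriv j a) (slab T) :=
  contDiffOn_fderiv_apply ha contDiffOn_const

theorem contDiffOn_spaceLaplacian {a : SpaceTime → ℂ} (ha : ContDiffOn ℝ ∞ a (slab T)) :
    ContDiffOn ℝ ∞ (spaceLaplacian a) (slab T) :=
  ContDiffOn.sum fun j _ => contDiffOn_partialDeriv (contDiffOn_partialDeriv ha j) j

theorem spaceDeriv_eq {ψ : SpaceTime → ℂ} {z : SpaceTime} (h : DifferentiableAt ℝ ψ z)
    (j : Fin 3) : spaceDeriv j ψ z = partialDeriv j ψ z := by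
  rw [spaceDeriv, (hasFDerivAt_space_slice h.hasFDerivAt).fderiv]
  simp [partialDeriv]

theorem timeDeriv_eq {ψ : SpaceTime → ℂ} {z : SpaceTime} (h : DifferentiableAt ℝ ψ z) :
    timeDeriv ψ z = fderiv ℝ ψ z (1, 0) :=
  (hasDerivAt_time_slice h.hasFDerivAt).deriv

/-- The oscillating factor `e^{iS/h}`. -/
def wave (S : SpaceTime → ℝ) (h : ℝ) (z : SpaceTime) : ℂ := Complex.exp (Complex.I * S z / h)

/-- The phase is real, so the oscillating factor does not affect the remainder estimate. -/
theorem norm_wave (S : SpaceTime → ℝ) (h : ℝ) (z : SpaceTime) : ‖wave S h z‖ = 1 := by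
  have : Complex.I * S z / h = ((S z / h : ℝ) : ℂ) * Complex.I := by push_cast; ring
  rw [wave, this, Complex.norm_exp_ofReal_mul_I]

variable {S : SpaceTime → ℝ} (hS : ContDiffOn ℝ ∞ S (slab T))

include hS

theorem contDiffOn_wave (h : ℝ) : ContDiffOn ℝ ∞ (wave S h) (slab T) :=
  ((contDiffOn_const.mul (Complex.ofRealCLM.contDiff.comp_contDiffOn hS)).div_const _).cexp

theorem fderiv_mul_wave (h : ℝ) {a : SpaceTime → ℂ} (ha : ContDiffOn ℝ ∞ a (slab T))
    {z : SpaceTime} (hz : z ∈ slab T) (v : SpaceTime) :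
    fderiv ℝ (fun z => a z * wave S h z) z v
      = (fderiv ℝ a z v + Complex.I * (fderiv ℝ S z v : ℝ) / h * a z) * wave S h z := by
  have hSd : HasFDerivAt (fun z => (S z : ℂ)) (Complex.ofRealCLM ∘L fderiv ℝ S z) z :=
    Complex.ofRealCLM.hasFDerivAt.comp z (differentiableAt_of_slab hS hz).hasFDerivAt
  have hW : HasFDerivAt (wave S h) _ z := ((hSd.const_mul Complex.I).mul_const ((h : ℂ)⁻¹)).cexp
  have h1 := (differentiableAt_of_slab ha hz).hasFDerivAt.mul hW
  have h2 : HasFDerivAt (fun z => a z * wave S h z) _ z := h1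
  rw [h2.fderiv]
  simp [wave, div_eq_mul_inv]
  ring

end Wave

/-! ### The Schrödinger operator on amplitudes, ordered by powers of `h` -/

section Schrodinger

variable {T : ℝ} {S : SpaceTime → ℝ} {A : SpaceTime → Space} {e c : ℝ}

/-- The kinetic momentum `∂_j S - (e/c) A_j` belonging to the phase `S`. -/
def kineticMomentum (e c : ℝ) (A : SpaceTime → Space) (S : SpaceTime → ℝ) (j : Fin 3)
    (z : SpaceTime) : ℂ :=
  ((fderiv ℝ S z (0, EuclideanSpace.single j 1) - e / c * A z j : ℝ) : ℂ)

theorem contDiffOn_kineticMomentum (hS : ContDiffOn ℝ ∞ S (slab T)) (hA : ContDiff ℝ ∞ A)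
    (j : Fin 3) : ContDiffOn ℝ ∞ (kineticMomentum e c A S j) (slab T) := by
  have hAj : ContDiff ℝ ∞ (fun z => A z j) := contDiff_euclidean.1 hA j
  exact Complex.ofRealCLM.contDiff.comp_contDiffOn
    ((contDiffOn_fderiv_apply hS contDiffOn_const).sub (contDiff_const.mul hAj).contDiffOn)

/-- The amplitude of the momentum operator applied to `a e^{iS/h}`. -/
def momentumAmplitude (e c h : ℝ) (A : SpaceTime → Space) (S : SpaceTime → ℝ) (j : Fin 3)
    (a : SpaceTime → ℂ) (z : SpaceTime) : ℂ :=
  -Complex.I * h * partialDeriv j a z + kineticMomentum e c A S j z * a z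

theorem contDiffOn_momentumAmplitude (hS : ContDiffOn ℝ ∞ S (slab T)) (hA : ContDiff ℝ ∞ A)
    (h : ℝ) {a : SpaceTime → ℂ} (ha : ContDiffOn ℝ ∞ a (slab T)) (j : Fin 3) :
    ContDiffOn ℝ ∞ (momentumAmplitude e c h A S j a) (slab T) :=
  (contDiffOn_const.mul (contDiffOn_partialDeriv ha j)).add
    ((contDiffOn_kineticMomentum hS hA j).mul ha)

/-- The factorization of `ψ` is required only on the slab, because in the second application of the
operator it is known only there. -/
theorem momentum_mul_wave (hS : ContDiffOn ℝ ∞ S (slab T)) {h : ℝ} (hh : h ≠ 0)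
    {a : SpaceTime → ℂ} (ha : ContDiffOn ℝ ∞ a (slab T)) {ψ : SpaceTime → ℂ}
    (hψ : ∀ z ∈ slab T, ψ z = a z * wave S h z) {z : SpaceTime} (hz : z ∈ slab T) (j : Fin 3) :
    momentum e c h A j ψ z = momentumAmplitude e c h A S j a z * wave S h z := by
  have hev : ψ =ᶠ[𝓝 z] fun z => a z * wave S h z := by
    filter_upwards [(isOpen_slab T).mem_nhds hz] with y hy using hψ y hy
  have hd : DifferentiableAt ℝ ψ z :=
    (differentiableAt_of_slab (ha.mul (contDiffOn_wave hS h)) hz).congr_of_eventuallyEq hev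
  rw [momentum, spaceDeriv_eq hd, partialDeriv, hev.fderiv_eq, fderiv_mul_wave hS h ha hz,
    hψ z hz, momentumAmplitude, kineticMomentum, partialDeriv]
  have hhC : (h : ℂ) ≠ 0 := by exact_mod_cast hh
  push_cast
  field_simp
  linear_combination (-(fderiv ℝ S z (0, EuclideanSpace.single j 1) : ℂ) * a z * wave S h z)
    * Complex.I_sq

theorem momentum_momentum_mul_wave (hS : ContDiffOn ℝ ∞ S (slab T)) (hA : ContDiff ℝ ∞ A) {h : ℝ}
    (hh : h ≠ 0) {a : SpaceTime → ℂ} (ha : ContDiffOn ℝ ∞ a (slab T)) {z : SpaceTime}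
    (hz : z ∈ slab T) (j : Fin 3) :
    momentum e c h A j (momentum e c h A j (fun z => a z * wave S h z)) z
      = (-(h : ℂ) ^ 2 * partialDeriv j (partialDeriv j a) z
        - Complex.I * h * (2 * kineticMomentum e c A S j z * partialDeriv j a z
            + partialDeriv j (kineticMomentum e c A S j) z * a z)
        + kineticMomentum e c A S j z ^ 2 * a z) * wave S h z := by
  have ha' := contDiffOn_momentumAmplitude (e := e) (c := c) hS hA h ha j
  rw [momentum_mul_wave hS hh ha'
    (fun y hy => momentum_mul_wave hS hh ha (fun _ _ => rfl) hy j) hz j]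
  have h1 : partialDeriv j (momentumAmplitude e c h A S j a) z
      = -Complex.I * h * partialDeriv j (partialDeriv j a) z
        + (kineticMomentum e c A S j z * partialDeriv j a z
          + partialDeriv j (kineticMomentum e c A S j) z * a z) := by
    have hd := ((differentiableAt_of_slab (contDiffOn_partialDeriv ha j) hz).hasFDerivAt.const_mul
      (-Complex.I * h)).add ((differentiableAt_of_slab (contDiffOn_kineticMomentum
        (e := e) (c := c) hS hA j) hz).hasFDerivAt.mul (differentiableAt_of_slab ha hz).hasFDerivAt)
    have hd' : HasFDerivAt (momentumAmplitude e c h A S j a) _ z := hd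
    rw [partialDeriv, hd'.fderiv]
    simp [partialDeriv]
    ring
  rw [momentumAmplitude, h1, momentumAmplitude]
  linear_combination ((h : ℂ) ^ 2 * partialDeriv j (partialDeriv j a) z * wave S h z)
    * Complex.I_sq

/-- The transport operator acting on amplitudes. -/
def transport (e c μ : ℝ) (A : SpaceTime → Space) (S : SpaceTime → ℝ) (a : SpaceTime → ℂ)
    (z : SpaceTime) : ℂ :=
  fderiv ℝ a z (1, 0) + ((1 / (2 * μ) : ℝ) : ℂ) * ∑ j : Fin 3,
    (2 * kineticMomentum e c A S j z * partialDeriv j a z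
      + partialDeriv j (kineticMomentum e c A S j) z * a z)

/-- If the phase solves the Hamilton-Jacobi equation, the Schrödinger operator acts on the amplitude
of `a e^{iS/h}` as the transport operator plus a term of higher order in `h`. -/
theorem schrodinger_mul_wave {μ : ℝ} {φ : SpaceTime → ℝ} (hS : ContDiffOn ℝ ∞ S (slab T))
    (hA : ContDiff ℝ ∞ A) {h : ℝ} (hh : h ≠ 0) {a : SpaceTime → ℂ}
    (ha : ContDiffOn ℝ ∞ a (slab T)) {z : SpaceTime} (hz : z ∈ slab T)
    (hHJ : ((fderiv ℝ S z (1, 0) : ℝ) : ℂ) = -(((e * φ z : ℝ) : ℂ) + ((1 / (2 * μ) : ℝ) : ℂ) *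
      ∑ j : Fin 3, kineticMomentum e c A S j z ^ 2)) :
    schrodinger e c μ h φ A (fun z => a z * wave S h z) z
      = (Complex.I * h * transport e c μ A S a z
        + ((1 / (2 * μ) : ℝ) : ℂ) * (h : ℂ) ^ 2 * spaceLaplacian a z) * wave S h z := by
  have hhC : (h : ℂ) ≠ 0 := by exact_mod_cast hh
  have hd := differentiableAt_of_slab (ha.mul (contDiffOn_wave hS h)) hz
  rw [schrodinger, timeDeriv_eq hd, fderiv_mul_wave hS h ha hz]
  simp only [momentum_momentum_mul_wave hS hA hh ha hz]
  rw [← Finset.sum_mul, Finset.sum_add_distrib, Finset.sum_sub_distrib, ← Finset.mul_sum,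
    ← Finset.mul_sum, ← Finset.sum_mul, transport, spaceLaplacian, hHJ]
  generalize ∑ j : Fin 3, kineticMomentum e c A S j z ^ 2 = s₁
  generalize ∑ j : Fin 3, (2 * kineticMomentum e c A S j z * partialDeriv j a z
      + partialDeriv j (kineticMomentum e c A S j) z * a z) = s₂
  generalize ∑ j : Fin 3, partialDeriv j (partialDeriv j a) z = s₃
  generalize ((1 / (2 * μ) : ℝ) : ℂ) = m
  generalize ((e * φ z : ℝ) : ℂ) = f
  generalize fderiv ℝ a z (1, 0) = a'
  field_simp
  linear_combination (-(f + m * s₁) * a z * wave S h z) * Complex.I_sq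

theorem fderiv_sum_smul {a : ℕ → SpaceTime → ℂ} {z : SpaceTime}
    (ha : ∀ k, DifferentiableAt ℝ (a k) z) (r : ℕ → ℂ) (N : ℕ) (v : SpaceTime) :
    fderiv ℝ (fun z => ∑ k ∈ Finset.range N, r k * a k z) z v
      = ∑ k ∈ Finset.range N, r k * fderiv ℝ (a k) z v := by
  have h := HasFDerivAt.fun_sum (u := Finset.range N)
    fun k _ => (ha k).hasFDerivAt.const_mul (r k)
  rw [h.fderiv]
  simp

theorem partialDeriv_congr {a b : SpaceTime → ℂ} {z : SpaceTime} (h : a =ᶠ[𝓝 z] b) (j : Fin 3) :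
    partialDeriv j a z = partialDeriv j b z := by
  rw [partialDeriv, partialDeriv, h.fderiv_eq]

theorem spaceLaplacian_congr {a b : SpaceTime → ℂ} {z : SpaceTime} (h : a =ᶠ[𝓝 z] b) :
    spaceLaplacian a z = spaceLaplacian b z := by
  refine Finset.sum_congr rfl fun j _ => partialDeriv_congr ?_ j
  filter_upwards [h.eventually_nhds] with y hy using partialDeriv_congr hy j

theorem spaceLaplacian_sum {a : ℕ → SpaceTime → ℂ} (ha : ∀ k, ContDiffOn ℝ ∞ (a k) (slab T))
    {z : SpaceTime} (hz : z ∈ slab T) (r : ℕ → ℂ) (N : ℕ) :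
    spaceLaplacian (fun z => ∑ k ∈ Finset.range N, r k * a k z) z
      = ∑ k ∈ Finset.range N, r k * spaceLaplacian (a k) z := by
  simp only [spaceLaplacian, Finset.mul_sum]
  rw [Finset.sum_comm]
  refine Finset.sum_congr rfl fun j _ => ?_
  have hev : partialDeriv j (fun z => ∑ k ∈ Finset.range N, r k * a k z) =ᶠ[𝓝 z]
      fun z => ∑ k ∈ Finset.range N, r k * partialDeriv j (a k) z := by
    filter_upwards [(isOpen_slab T).mem_nhds hz] with y hy
    exact fderiv_sum_smul (fun k => differentiableAt_of_slab (ha k) hy) r N _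
  rw [partialDeriv_congr hev]
  exact fderiv_sum_smul
    (fun k => differentiableAt_of_slab (contDiffOn_partialDeriv (ha k) j) hz) r N _

theorem transport_sum {μ : ℝ} {a : ℕ → SpaceTime → ℂ} (ha : ∀ k, ContDiffOn ℝ ∞ (a k) (slab T))
    {z : SpaceTime} (hz : z ∈ slab T) (r : ℕ → ℂ) (N : ℕ) :
    transport e c μ A S (fun z => ∑ k ∈ Finset.range N, r k * a k z) z
      = ∑ k ∈ Finset.range N, r k * transport e c μ A S (a k) z := by
  have hd := fun k => differentiableAt_of_slab (ha k) hz
  have hp : ∀ j, partialDeriv j (fun z => ∑ k ∈ Finset.range N, r k * a k z) z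
      = ∑ k ∈ Finset.range N, r k * partialDeriv j (a k) z :=
    fun j => fderiv_sum_smul hd r N _
  simp only [transport, fderiv_sum_smul hd, hp, mul_add, Finset.sum_add_distrib, Fin.sum_univ_three,
    Finset.mul_sum]
  simp only [← Finset.sum_add_distrib]
  refine Finset.sum_congr rfl fun k _ => ?_
  ring

/-- If the amplitudes satisfy the transport equations, only the last Laplacian survives. -/
theorem schrodinger_debyeSum {μ : ℝ} {φ : SpaceTime → ℝ} (hS : ContDiffOn ℝ ∞ S (slab T))
    (hA : ContDiff ℝ ∞ A) {h : ℝ} (hh : h ≠ 0) {a : ℕ → SpaceTime → ℂ}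
    (ha : ∀ k, ContDiffOn ℝ ∞ (a k) (slab T)) {z : SpaceTime} (hz : z ∈ slab T)
    (hHJ : ((fderiv ℝ S z (1, 0) : ℝ) : ℂ) = -(((e * φ z : ℝ) : ℂ) + ((1 / (2 * μ) : ℝ) : ℂ) *
      ∑ j : Fin 3, kineticMomentum e c A S j z ^ 2))
    (h0 : transport e c μ A S (a 0) z = 0)
    (hsucc : ∀ k, transport e c μ A S (a (k + 1)) z
      = Complex.I * ((1 / (2 * μ) : ℝ) : ℂ) * spaceLaplacian (a k) z) (N : ℕ) :
    schrodinger e c μ h φ A (debyeSum S a h N) z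
      = ((1 / (2 * μ) : ℝ) : ℂ) * (h : ℂ) ^ (N + 2) * spaceLaplacian (a N) z * wave S h z := by
  have hsum : ContDiffOn ℝ ∞ (fun z => ∑ k ∈ Finset.range (N + 1), (h : ℂ) ^ k * a k z) (slab T) :=
    ContDiffOn.sum fun k _ => contDiffOn_const.mul (ha k)
  have h1 := schrodinger_mul_wave (φ := φ) hS hA hh hsum hz hHJ
  rw [transport_sum ha hz, spaceLaplacian_sum ha hz] at h1
  refine Eq.trans h1 ?_
  -- The transport sum loses its term `k = 0` and the Laplacian sum its term `k = N`. What remains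
  -- cancels: the transport term of index `k + 1` against the Laplacian term of index `k`.
  rw [Finset.sum_range_succ', Finset.sum_range_succ (fun k => (h : ℂ) ^ k * spaceLaplacian (a k) z)]
  simp only [h0, hsucc, mul_zero, add_zero]
  have h2 : Complex.I * h * ∑ k ∈ Finset.range N, (h : ℂ) ^ (k + 1) *
      (Complex.I * ((1 / (2 * μ) : ℝ) : ℂ) * spaceLaplacian (a k) z)
      = -(((1 / (2 * μ) : ℝ) : ℂ) * (h : ℂ) ^ 2 *
        ∑ k ∈ Finset.range N, (h : ℂ) ^ k * spaceLaplacian (a k) z) := by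
    rw [Finset.mul_sum, Finset.mul_sum, ← Finset.sum_neg_distrib]
    refine Finset.sum_congr rfl fun k _ => ?_
    linear_combination ((h : ℂ) ^ (k + 2) * ((1 / (2 * μ) : ℝ) : ℂ) * spaceLaplacian (a k) z)
      * Complex.I_sq
  rw [h2]
  ring

end Schrodinger

/-! ### The Maxwell Hamiltonian and the sequence of amplitudes -/

section Main

/-- The Hamiltonian as a function on the extended phase space. -/
def phaseHamiltonian (e c μ : ℝ) (φ : SpaceTime → ℝ) (A : SpaceTime → Space)
    (w : ℝ × Space × Space) : ℝ :=
  hamiltonian e c μ φ A w.2.1 w.2.2 w.1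

variable {e c μ : ℝ} {φ : SpaceTime → ℝ} {A : SpaceTime → Space}

theorem contDiff_phaseHamiltonian (hφ : ContDiff ℝ ∞ φ) (hA : ContDiff ℝ ∞ A) :
    ContDiff ℝ ∞ (phaseHamiltonian e c μ φ A) := by
  have h1 : ContDiff ℝ ∞ (fun w : ℝ × Space × Space => ((w.1, w.2.1) : SpaceTime)) := by fun_prop
  have h2 : ContDiff ℝ ∞ (fun w : ℝ × Space × Space => w.2.2) := by fun_prop
  have h3 : ContDiff ℝ ∞ (fun w : ℝ × Space × Space => φ (w.1, w.2.1)) := hφ.comp h1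
  have h4 : ContDiff ℝ ∞ (fun w : ℝ × Space × Space => A (w.1, w.2.1)) := hA.comp h1
  have h5 : ContDiff ℝ ∞ (fun w : ℝ × Space × Space => ‖w.2.2 - (e / c) • A (w.1, w.2.1)‖ ^ 2) :=
    (h2.sub (h4.const_smul (e / c))).norm_sq ℝ
  unfold phaseHamiltonian hamiltonian
  exact (contDiff_const.mul h3).add (contDiff_const.mul h5)

theorem momentumGradient_phaseHamiltonian (w : ℝ × Space × Space) :
    momentumGradient (phaseHamiltonian e c μ φ A) w
      = (1 / μ) • (w.2.2 - (e / c) • A (w.1, w.2.1)) := by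
  have h1 : HasFDerivAt (fun q : Space => q - (e / c) • A (w.1, w.2.1))
      (ContinuousLinearMap.id ℝ Space) w.2.2 := (hasFDerivAt_id _).sub_const _
  have h2 : HasFDerivAt (fun q : Space => hamiltonian e c μ φ A w.2.1 q w.1) _ w.2.2 :=
    (h1.norm_sq.const_mul (1 / (2 * μ))).const_add (e * φ (w.1, w.2.1))
  change ∇ (fun q : Space => hamiltonian e c μ φ A w.2.1 q w.1) w.2.2 = _
  rw [gradient, h2.fderiv, LinearIsometryEquiv.symm_apply_eq]
  generalize w.2.2 - (e / c) • A (w.1, w.2.1) = b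
  ext v
  simp only [InnerProductSpace.toDual_apply_apply, real_inner_smul_left]
  simp
  ring

/-- Differentiating `Φ⁻¹ ∘ Φ = id` gives a left inverse of the derivative. -/
theorem isRegularFlow_of_diffeomorph {T : ℝ} {x : ℝ → Space → Space}
    (hx : ContDiffOn ℝ ∞ (fun z : SpaceTime => x z.1 z.2) (slab T))
    (hdiffeo : ∀ t : ℝ, |t| < T → ∃ Φ : Diffeomorph 𝓘(ℝ, Space) 𝓘(ℝ, Space) Space Space ∞,
      ∀ x₀ : Space, Φ x₀ = x t x₀) : IsRegularFlow T x := by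
  refine ⟨hx, fun t ht => ?_, fun t ht q => ?_⟩
  · obtain ⟨Φ, hΦ⟩ := hdiffeo t ht
    rw [← funext hΦ]
    exact Φ.bijective
  · obtain ⟨Φ, hΦ⟩ := hdiffeo t ht
    rw [← funext hΦ]
    have h1 : HasFDerivAt Φ (fderiv ℝ Φ q) q :=
      (Φ.contMDiff.contDiff.differentiable (by simp) q).hasFDerivAt
    have h2 : HasFDerivAt Φ.symm (fderiv ℝ Φ.symm (Φ q)) (Φ q) :=
      (Φ.symm.contMDiff.contDiff.differentiable (by simp) (Φ q)).hasFDerivAt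
    have h3 : fderiv ℝ Φ.symm (Φ q) ∘L fderiv ℝ Φ q = ContinuousLinearMap.id ℝ Space := by
      refine (h2.comp q h1).unique ?_
      have : Φ.symm ∘ Φ = id := funext Φ.symm_apply_apply
      rw [this]
      exact hasFDerivAt_id q
    exact Function.LeftInverse.injective (g := fderiv ℝ Φ.symm (Φ q)) (DFunLike.congr_fun h3)

/-- With `∇S = P`, the first-order part is the derivative along the velocity `v = (P - (e/c)A)/μ`,
which is `H_p`, the velocity of the rays. The zeroth-order coefficient is `½ div v`. -/
theorem transport_eq_of_phase {S : SpaceTime → ℝ} {P : SpaceTime → Space} {z : SpaceTime}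
    (hP : ∀ v, fderiv ℝ S z (0, v) = inner ℝ (P z) v) (hμ : 0 < μ) (a : SpaceTime → ℂ) :
    transport e c μ A S a z = fderiv ℝ a z (1, (1 / μ) • (P z - (e / c) • A z))
      + (((1 / (2 * μ) : ℝ) : ℂ) * ∑ j : Fin 3, partialDeriv j (kineticMomentum e c A S j) z)
        * a z := by
  have hkin : ∀ j, kineticMomentum e c A S j z = ((P z j - e / c * A z j : ℝ) : ℂ) := by
    intro j
    rw [kineticMomentum, hP, EuclideanSpace.inner_single_right]
    simp
  have hsplit : (((1 : ℝ), (1 / μ) • (P z - (e / c) • A z)) : SpaceTime)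
      = (1, 0) + ∑ j : Fin 3, (1 / μ * (P z j - e / c * A z j)) •
        ((0, EuclideanSpace.single j 1) : SpaceTime) := by
    refine Prod.ext (by simp [Fin.sum_univ_three]) ?_
    ext i
    fin_cases i <;> simp [Fin.sum_univ_three]
  have hμC : (μ : ℂ) ≠ 0 := by exact_mod_cast hμ.ne'
  rw [hsplit, map_add, map_sum]
  simp only [map_smul, transport, hkin, Complex.real_smul, Fin.sum_univ_three]
  simp only [partialDeriv]
  push_cast
  field_simp
  ring

theorem sum_kineticMomentum_sq {S : SpaceTime → ℝ} {P : SpaceTime → Space} {z : SpaceTime}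
    (hP : ∀ v, fderiv ℝ S z (0, v) = inner ℝ (P z) v) :
    ∑ j : Fin 3, kineticMomentum e c A S j z ^ 2 = ((‖P z - (e / c) • A z‖ ^ 2 : ℝ) : ℂ) := by
  rw [EuclideanSpace.norm_sq_eq]
  push_cast
  refine Finset.sum_congr rfl fun j _ => ?_
  rw [kineticMomentum, hP, EuclideanSpace.inner_single_right, ← Complex.ofReal_pow,
    ← Complex.ofReal_pow]
  simp

/-- A sequence of amplitudes solving the transport equations, supported in the ray tube. -/
theorem exists_amplitudes {T : ℝ} (hT : 0 < T) {x : ℝ → Space → Space} (hx : IsRegularFlow T x)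
    (hx0 : ∀ q, x 0 q = q) {U : SpaceTime → Space}
    (hU : ∀ z ∈ slab T, fderiv ℝ (fun z : SpaceTime => x z.1 z.2) z (1, 0) = U (rayMap x z))
    {d : SpaceTime → ℂ} (hd : ContDiffOn ℝ ∞ d (slab T)) (m : ℂ)
    {a₀ : Space → ℂ} (ha₀ : ContDiff ℝ ∞ a₀) :
    ∃ a : ℕ → SpaceTime → ℂ, (∀ k, ContDiffOn ℝ ∞ (a k) (slab T)) ∧
      (∀ y, a 0 (0, y) = a₀ y) ∧ (∀ k y, a (k + 1) (0, y) = 0) ∧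
      (∀ z ∈ slab T, fderiv ℝ (a 0) z (1, U z) + d z * a 0 z = 0) ∧
      (∀ k, ∀ z ∈ slab T, fderiv ℝ (a (k + 1)) z (1, U z) + d z * a (k + 1) z
        = m * spaceLaplacian (a k) z) ∧
      ∀ k, ∀ z ∈ slab T, z.2 ∉ tsupport a₀ → a k (rayMap x z) = 0 := by
  have hzero : ContDiff ℝ ∞ (fun _ : Space => (0 : ℂ)) := contDiff_const
  obtain ⟨α, hα, hα0, hαt, hαv⟩ := exists_transport hT hx hx0 hU hd
    (F := fun _ => 0) contDiffOn_const ha₀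
  choose! sol hsol hsol0 hsolt hsolv using
    fun (F : SpaceTime → ℂ) (hF : ContDiffOn ℝ ∞ F (slab T)) =>
      exists_transport hT hx hx0 hU hd hF hzero
  let a : ℕ → SpaceTime → ℂ := fun k =>
    Nat.rec α (fun _ b => sol (fun z => m * spaceLaplacian b z)) k
  have hL : ∀ b, ContDiffOn ℝ ∞ b (slab T) →
      ContDiffOn ℝ ∞ (fun z => m * spaceLaplacian b z) (slab T) :=
    fun b hb => contDiffOn_const.mul (contDiffOn_spaceLaplacian hb)
  have ha : ∀ k, ContDiffOn ℝ ∞ (a k) (slab T) := by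
    intro k
    induction k with
    | zero => exact hα
    | succ k ih => exact hsol _ (hL _ ih)
  refine ⟨a, ha, hα0, fun k y => hsol0 _ (hL _ (ha k)) y, hαt,
    fun k z hz => hsolt _ (hL _ (ha k)) z hz, ?_⟩
  intro k
  induction k with
  | zero =>
    intro z hz hq
    exact hαv z.2 (image_eq_zero_of_notMem_tsupport hq) (fun _ _ => rfl) z.1 hz
  | succ k ih =>
    intro z hz hq
    refine hsolv _ (hL _ (ha k)) z.2 rfl (fun t ht => ?_) z.1 hz
    have hmem : (t, z.2) ∈ slab T := ht
    have hy : (t, x t z.2) ∈ slab T := ht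
    have hcont : ContinuousAt (fun y => (rayInv x y).2) (t, x t z.2) :=
      (ContDiffOn.contDiffAt_slab hx.contDiffOn_rayInv hy).continuousAt.snd
    have hinv : (rayInv x (t, x t z.2)).2 = z.2 := by
      have h := hx.rayInv_rayMap hmem
      exact (Prod.ext_iff.1 h).2
    -- Vanishing of `a k` on one ray would not control its Laplacian. Since the support is closed,
    -- nearby points also lie on rays starting outside it, so `a k` vanishes on a whole
    -- neighbourhood.
    have hnhds : (tsupport a₀)ᶜ ∈ 𝓝 (rayInv x (t, x t z.2)).2 := by
      rw [hinv]
      exact (isClosed_tsupport a₀).isOpen_compl.mem_nhds hq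
    have hev : a k =ᶠ[𝓝 (t, x t z.2)] fun _ => 0 := by
      filter_upwards [hcont hnhds, (isOpen_slab T).mem_nhds hy] with y hy1 hy2
      rw [← hx.rayMap_rayInv hy2]
      exact ih _ (rayInv_mem.2 hy2) hy1
    change m * spaceLaplacian (a k) (t, x t z.2) = 0
    have hzero' : ∀ j, partialDeriv j (fun _ => 0) = fun _ => 0 := fun j => by
      funext y
      simp [partialDeriv]
    rw [spaceLaplacian_congr hev]
    simp only [spaceLaplacian, hzero', Finset.sum_const_zero, mul_zero]

end Main

end WKB

end

/-! ### Assembly of the expansion -/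

theorem mainTheorem12
    (e c μ : ℝ) (hc : 0 < c) (hμ : 0 < μ)
    (φ : WKB.SpaceTime → ℝ) (hφ : ContDiff ℝ ∞ φ)
    (A : WKB.SpaceTime → WKB.Space) (hA : ContDiff ℝ ∞ A)
    (S₀ : WKB.Space → ℝ) (hS₀ : ContDiff ℝ ∞ S₀)
    (a₀ : WKB.Space → ℂ) (ha₀ : ContDiff ℝ ∞ a₀)
    (T : ℝ) (hT : 0 < T)
    (x p : ℝ → WKB.Space → WKB.Space)
    (hray : ∀ x₀ : WKB.Space,
      WKB.IsRay e c μ φ A S₀ x₀ T (fun t => x t x₀) (fun t => p t x₀))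
    (hdiffeo : ∀ t : ℝ, |t| < T →
      ∃ Φ : Diffeomorph 𝓘(ℝ, WKB.Space) 𝓘(ℝ, WKB.Space) WKB.Space WKB.Space ∞,
        ∀ x₀ : WKB.Space, Φ x₀ = x t x₀) :
    ∃ (S : WKB.SpaceTime → ℝ) (a : ℕ → WKB.SpaceTime → ℂ),
      WKB.IsDebyeExpansion e c μ φ A S₀ a₀ T S a ∧
      ∀ (k : ℕ) (t : ℝ) (y : WKB.Space), |t| < T →
        (t, y) ∉ WKB.rayTube e c μ φ A S₀ a₀ → a k (t, y) = 0 := by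
  open WKB in
  have hH : ContDiff ℝ ∞ (phaseHamiltonian e c μ φ A) := contDiff_phaseHamiltonian hφ hA
  have hxp : IsHamiltonFlow (phaseHamiltonian e c μ φ A) S₀ T x p :=
    ⟨fun q => (hray q).x_zero, fun q => (hray q).p_zero, fun q => (hray q).x_eq,
      fun q => (hray q).p_eq⟩
  have hx : IsRegularFlow T x := isRegularFlow_of_diffeomorph (hxp.contDiffOn_x hH hS₀) hdiffeo
  obtain ⟨S, P, hS, hP, hS0, hPp, hSP⟩ := hxp.exists_phase hH hS₀ hx hT
  have hU : ∀ z ∈ slab T, fderiv ℝ (fun z : SpaceTime => x z.1 z.2) z (1, 0)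
      = (fun z => (1 / μ) • (P z - (e / c) • A z)) (rayMap x z) := by
    intro z hz
    rw [hxp.fderiv_x_time hH hS₀ hz, momentumGradient_phaseHamiltonian]
    beta_reduce
    rw [hPp z hz]
    rfl
  have hd : ContDiffOn ℝ ∞ (fun z => ((1 / (2 * μ) : ℝ) : ℂ) *
      ∑ j : Fin 3, partialDeriv j (kineticMomentum e c A S j) z) (slab T) :=
    contDiffOn_const.mul (ContDiffOn.sum fun j _ =>
      contDiffOn_partialDeriv (contDiffOn_kineticMomentum hS hA j) j)
  obtain ⟨a, ha, ha0, hasucc, hat0, hatsucc, hav⟩ := exists_amplitudes hT hx hxp.x_zero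
    (U := fun z => (1 / μ) • (P z - (e / c) • A z)) hU hd
    (Complex.I * ((1 / (2 * μ) : ℝ) : ℂ)) ha₀
  refine ⟨S, a, ⟨hS, ha, ?_, hS0, ha0, hasucc, ?_⟩, ?_⟩
  · intro z hz
    have hSd := (differentiableAt_of_slab hS hz).hasFDerivAt
    have hgrad : ∇ (fun y : Space => S (z.1, y)) z.2 = P z := by
      rw [gradient, (hasFDerivAt_space_slice hSd).fderiv, LinearIsometryEquiv.symm_apply_eq]
      ext v
      simpa using (hSP z hz).1 v
    rw [(hasDerivAt_time_slice hSd).deriv, (hSP z hz).2, hgrad, neg_neg]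
    rfl
  · intro N K hK hKT
    -- The remainder is exactly `h^(N+2)/(2μ) Δ a_N` times a unimodular factor, so a bound for `Δ
    -- a_N` on `K` suffices.
    obtain ⟨C, hC⟩ := hK.exists_bound_of_continuousOn
      ((contDiffOn_spaceLaplacian (ha N)).continuousOn.mono hKT)
    refine ⟨1 / (2 * μ) * C, fun h hh _ z hz => ?_⟩
    have hzT := hKT hz
    have hHJ : ((fderiv ℝ S z (1, 0) : ℝ) : ℂ) = -(((e * φ z : ℝ) : ℂ) +
        ((1 / (2 * μ) : ℝ) : ℂ) * ∑ j : Fin 3, kineticMomentum e c A S j z ^ 2) := by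
      rw [sum_kineticMomentum_sq (hSP z hzT).1, (hSP z hzT).2, ← Complex.ofReal_mul,
        ← Complex.ofReal_add, ← Complex.ofReal_neg]
      rfl
    rw [schrodinger_debyeSum hS hA hh.ne' ha hzT hHJ
      ((transport_eq_of_phase (hSP z hzT).1 hμ _).trans (hat0 z hzT))
      (fun k => (transport_eq_of_phase (hSP z hzT).1 hμ _).trans (hatsucc k z hzT)) N]
    rw [norm_mul, norm_wave, mul_one, norm_mul, norm_mul, norm_pow, Complex.norm_real,
      Complex.norm_real, Real.norm_of_nonneg (by positivity), Real.norm_of_nonneg hh.le]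
    have h1 := mul_le_mul_of_nonneg_left (hC z hz)
      (show 0 ≤ 1 / (2 * μ) * h ^ (N + 2) by positivity)
    linarith
  · intro k t y ht hty
    have hmem : (t, y) ∈ slab T := ht
    have hxy : x t (rayInv x (t, y)).2 = y := congrArg Prod.snd (hx.rayMap_rayInv hmem)
    rw [← hx.rayMap_rayInv hmem]
    refine hav k _ (rayInv_mem.2 hmem) fun hq => hty ?_
    -- If the starting point were in the closed support, the given ray, with lifetime `τ = T`, would
    -- put `(t, y)` in the tube.
    exact ⟨_, hq, T, _, _, hray _, ht, hxy⟩
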